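/- Let $\mathbb T$ be the unit circle with normalized arc length $d\omega/2\pi$, and let $\|X\|_1=\frac1{2\pi}\int_{-\pi}^{\pi}\operatorname{tr}\sqrt{X^*X}\,d\omega$ and $\|X\|_2=\big(\frac1{2\pi}\int_{-\pi}^{\pi}\|X\|_F^2\,d\omega\big)^{1/2}$ for matrix functions on $\mathbb T$. (In)equalities between functions on $\mathbb T$ hold almost everywhere, and "proper" means analytic at $\infty$. Let $G_{zu}$ ($n_z\times1$) and $G_{yv}$ ($1\times n_v$) be matrices of rational functions with real coefficients such that $G_{zu}^*G_{zu}$ and $G_{yv}G_{yv}^*$ have no zeros and no poles on $\mathbb T$. Let $G_{yu}$ be real rational and strictly proper. Let $H\in\mathcal{RH}_\infty$ (real, rational, proper, no poles in $|z|\ge1$) have no zeros on $\mathbb T$. Let $K$ be real rational and proper, with $S=1/(1-KG_{yu})\in\mathcal{RH}_\infty$, and let $\alpha>0$. Let $\Theta(K)$ be the set of pairs $(C,D)$ of measurable functions $\mathbb T\to\mathbb C$ with $DC=K$ and $\|CSG_{yv}\|_2^2\le\alpha$. A pair is called optimal if it is in $\Theta(K)$ and minimizes $\|DSHG_{zu}\|_2^2$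 over $\Theta(K)$. (a) $$\inf_{(C,D)\in\Theta(K)}\|DSHG_{zu}\|_2^2\ \ge\ \frac1\alpha\,\|KS^2HG_{zu}G_{yv}\|_1^2 .$$ (b) Suppose in addition that $K$ has no poles on $\mathbb T$ and that $K=\frac{MQ-U}{NQ+V}$ with $Q\in\mathcal{RH}_\infty$, where $G_{yu}=NM^{-1}$ is a coprime factorization over $\mathcal{RH}_\infty$ with $U,V\in\mathcal{RH}_\infty$, $VM+UN=1$. Then there is $(C,D)\in\Theta(K)$, with $C$ (the boundary function of) an outer function in the Hardy space $\mathcal H_2$ of $\{|z|>1\}$ and $D\in L_2(\mathbb T)$, that attains the minimum, and equality holds in (a). (c) If $K$ has no poles on $\mathbb T$, then $\|KS^2HG_{zu}G_{yv}\|_1<\infty$. Whenever $K\neq0$ and $\|KS^2HG_{zu}G_{yv}\|_1<\infty$, a pair $(C,D)$ of measurable functions is optimal if and only if $DC=K$ and $$|C|^2=\frac{\alpha}{\|KS^2HG_{zu}G_{yv}\|_1}\sqrt{\frac{G_{zu}^*G_{zu}}{G_{yv}G_{yv}^*}}\;|KH|\quad\text{on }\mathbb T,$$ and also if and only if $(C,D)\in\Theta(K)$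 and $\|DSHG_{zu}\|_2^2=\frac1\alpha\|KS^2HG_{zu}G_{yv}\|_1^2$. (d) If $K=0$, then $(C,0)$ is optimal, with cost $0$, for every measurable $C$ with $\|CSG_{yv}\|_2^2\le\alpha$. -/

import Mathlib

open MeasureTheory Filter Topology
open scoped Matrix MatrixOrder ENNReal

noncomputable section

namespace NetworkedControl

/-! ## The unit circle -/

/-- The Borel sigma-algebra of the unit circle. -/
instance circleMeasurableSpace : MeasurableSpace Circle := borel Circle

instance circleBorelSpace : BorelSpace Circle := ⟨rfl⟩

/-- The normalised arc length `dω / 2π` on the unit circle, `ω ∈ (-π, π]`. -/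
def arcMeasure : Measure Circle :=
  ENNReal.ofReal (1 / (2 * Real.pi)) •
    (volume.restrict (Set.Ioc (-Real.pi) Real.pi)).map (fun ω : ℝ => Circle.exp ω)

/-- `‖X‖₁ = (1/2π) ∫ tr √(X* X) dω`, for matrix-valued functions on the circle. -/
def norm1 {m n : ℕ} (X : Circle → Matrix (Fin m) (Fin n) ℂ) : ℝ≥0∞ :=
  ∫⁻ ζ, ENNReal.ofReal (CFC.sqrt ((X ζ)ᴴ * X ζ)).trace.re ∂arcMeasure

/-- `‖X‖₂ = ((1/2π) ∫ ‖X‖_F² dω)^(1/2)`, for matrix-valued functions on the circle. -/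
def norm2 {m n : ℕ} (X : Circle → Matrix (Fin m) (Fin n) ℂ) : ℝ≥0∞ :=
  (∫⁻ ζ, ENNReal.ofReal (∑ i, ∑ j, ‖X ζ i j‖ ^ 2) ∂arcMeasure) ^ (1 / 2 : ℝ)

/-! ## Real rational transfer functions -/

/-- The value of a real rational function at a complex point. -/
def evalAt (K : RatFunc ℝ) (z : ℂ) : ℂ := K.eval (algebraMap ℝ ℂ) z

/-- The values of a real rational transfer matrix on the circle. -/
def onCircle {m n : ℕ} (X : Matrix (Fin m) (Fin n) (RatFunc ℝ)) (ζ : Circle) :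
    Matrix (Fin m) (Fin n) ℂ :=
  X.map fun K => evalAt K ζ

/-- `z` is a pole of `K` (`num` and `denom` are coprime). -/
def HasPole (K : RatFunc ℝ) (z : ℂ) : Prop := Polynomial.aeval z K.denom = 0

/-- `z` is a zero of `K`; every point is a zero of the zero function. -/
def HasZero (K : RatFunc ℝ) (z : ℂ) : Prop := Polynomial.aeval z K.num = 0

/-- Proper: analytic at infinity. -/
def IsProper (K : RatFunc ℝ) : Prop := K.num.degree ≤ K.denom.degree

/-- Strictly proper: proper with value `0` at infinity. -/
def IsStrictlyProper (K : RatFunc ℝ) : Prop := K.num.degree < K.denom.degree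

/-- Real, rational and proper, without poles on the unit circle (the space is the same for
every exponent `p`). -/
def IsRL (K : RatFunc ℝ) : Prop := IsProper K ∧ ∀ ζ : Circle, ¬ HasPole K ζ

/-- `RH∞`: real, rational, proper and stable. -/
def IsRHinf (K : RatFunc ℝ) : Prop := IsProper K ∧ ∀ z : ℂ, 1 ≤ ‖z‖ → ¬ HasPole K z

/-- The para-Hermitian conjugate `X*(z) = X(1/z)ᵀ`, the rational matrix that equals the conjugate
transpose of `X` on the unit circle. -/
def paraConj {m n : ℕ} (X : Matrix (Fin m) (Fin n) (RatFunc ℝ)) :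
    Matrix (Fin n) (Fin m) (RatFunc ℝ) :=
  Xᵀ.map fun K => K.eval RatFunc.C (RatFunc.X)⁻¹

/-- A rational function without zeros and poles on the unit circle. -/
def NoZerosPolesOnCircle (K : RatFunc ℝ) : Prop :=
  ∀ ζ : Circle, ¬ HasZero K ζ ∧ ¬ HasPole K ζ

/-- `K = (MQ - U) / (NQ + V)` with `Q ∈ RH∞`, for a coprime factorization `G = N M⁻¹` over `RH∞`
with Bezout identity `VM + UN = 1`. -/
def IsYoula (G K : RatFunc ℝ) : Prop :=
  ∃ M N U V Q : RatFunc ℝ,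
    IsRHinf M ∧ IsRHinf N ∧ IsRHinf U ∧ IsRHinf V ∧ IsRHinf Q ∧
    M ≠ 0 ∧ G = N / M ∧ V * M + U * N = 1 ∧
    N * Q + V ≠ 0 ∧ K = (M * Q - U) / (N * Q + V)

/-! ## Hardy space and outer functions on the exterior of the unit disc -/

/-- `F ∈ H²`: `z ↦ F (1/z)` is analytic on the open unit disc (`F` is only looked at on `|z| > 1`,
its value at infinity is `f 0`) and `sup_{r > 1} ‖F_r‖₂ < ∞`, where `F_r(ζ) = F (r ζ)`. -/
def IsH2 (F : ℂ → ℂ) : Prop :=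
  (∃ f : ℂ → ℂ, DifferentiableOn ℂ f (Metric.ball 0 1) ∧ ∀ z : ℂ, 1 < ‖z‖ → F z = f z⁻¹) ∧
  (⨆ r : {r : ℝ // 1 < r}, eLpNorm (fun ζ : Circle => F ((r : ℝ) * ζ)) 2 arcMeasure) < ⊤

/-- `F` is outer on `|z| > 1`:
`F(z) = c exp ((1/2π) ∫ (z + e^{iω}) / (z - e^{iω}) log φ(e^{iω}) dω)` with `|c| = 1`, `φ > 0`
measurable and `log φ ∈ L¹`. -/
def IsOuter (F : ℂ → ℂ) : Prop :=
  ∃ (c : ℂ) (φ : Circle → ℝ), ‖c‖ = 1 ∧ Measurable φ ∧ (∀ ζ, 0 < φ ζ) ∧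
    Integrable (fun ζ => Real.log (φ ζ)) arcMeasure ∧
    ∀ z : ℂ, 1 < ‖z‖ →
      F z = c * Complex.exp
        (∫ ζ : Circle, (z + (ζ : ℂ)) / (z - (ζ : ℂ)) * ((Real.log (φ ζ) : ℝ) : ℂ) ∂arcMeasure)

/-- `C` is, almost everywhere on the circle, the radial limit of `F`. -/
def IsBoundaryValue (F : ℂ → ℂ) (C : Circle → ℂ) : Prop :=
  ∀ᵐ ζ : Circle ∂arcMeasure, Tendsto (fun r : ℝ => F ((r : ℂ) * (ζ : ℂ))) (𝓝[>] 1) (𝓝 (C ζ))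

/-- The function `C` on the circle is (the boundary function of) an outer function in `H²`. -/
def IsOuterH2 (C : Circle → ℂ) : Prop :=
  ∃ F : ℂ → ℂ, IsH2 F ∧ IsOuter F ∧ IsBoundaryValue F C

/-! ## The optimal factorization problem -/

variable {nz nv : ℕ}

/-- `S = 1 / (1 - K G_yu)`. -/
def sens (Gyu K : RatFunc ℝ) : RatFunc ℝ := 1 / (1 - K * Gyu)

/-- The feasible pairs: functions on the circle with `‖C S G_yv‖₂² ≤ α` and `D C = K`. -/
def feasible (Gyu : RatFunc ℝ) (Gyv : Matrix (Fin 1) (Fin nv) (RatFunc ℝ)) (α : ℝ)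
    (K : RatFunc ℝ) : Set ((Circle → ℂ) × (Circle → ℂ)) :=
  {p | AEMeasurable p.1 arcMeasure ∧ AEMeasurable p.2 arcMeasure ∧
    norm2 (fun ζ => (p.1 ζ * evalAt (sens Gyu K) ζ) • onCircle Gyv ζ) ^ 2 ≤ ENNReal.ofReal α ∧
    ∀ᵐ ζ ∂arcMeasure, p.2 ζ * p.1 ζ = evalAt K ζ}

/-- The noise-induced cost `‖D S H G_zu‖₂²`. -/
def cost (Gyu H : RatFunc ℝ) (Gzu : Matrix (Fin nz) (Fin 1) (RatFunc ℝ)) (K : RatFunc ℝ)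
    (D : Circle → ℂ) : ℝ≥0∞ :=
  norm2 (fun ζ => (D ζ * evalAt (sens Gyu K) ζ * evalAt H ζ) • onCircle Gzu ζ) ^ 2

/-- `‖K S² H G_zu G_yv‖₁`. -/
def loopNorm (Gyu H : RatFunc ℝ) (Gzu : Matrix (Fin nz) (Fin 1) (RatFunc ℝ))
    (Gyv : Matrix (Fin 1) (Fin nv) (RatFunc ℝ)) (K : RatFunc ℝ) : ℝ≥0∞ :=
  norm1 (fun ζ => (evalAt K ζ * evalAt (sens Gyu K) ζ ^ 2 * evalAt H ζ) •
    (onCircle Gzu ζ * onCircle Gyv ζ))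

/-- The lower bound `(1/α) ‖K S² H G_zu G_yv‖₁²`. -/
def bound (Gyu H : RatFunc ℝ) (Gzu : Matrix (Fin nz) (Fin 1) (RatFunc ℝ))
    (Gyv : Matrix (Fin 1) (Fin nv) (RatFunc ℝ)) (α : ℝ) (K : RatFunc ℝ) : ℝ≥0∞ :=
  ENNReal.ofReal (1 / α) * loopNorm Gyu H Gzu Gyv K ^ 2

/-- `(C, D)` is feasible and minimises the cost over the feasible pairs. -/
def IsOptimal (Gyu H : RatFunc ℝ) (Gzu : Matrix (Fin nz) (Fin 1) (RatFunc ℝ))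
    (Gyv : Matrix (Fin 1) (Fin nv) (RatFunc ℝ)) (α : ℝ) (K : RatFunc ℝ)
    (C D : Circle → ℂ) : Prop :=
  (C, D) ∈ feasible Gyu Gyv α K ∧
    ∀ p ∈ feasible Gyu Gyv α K, cost Gyu H Gzu K D ≤ cost Gyu H Gzu K p.2

/-- Almost everywhere on the circle,
`|C|² = (α / ‖K S² H G_zu G_yv‖₁) * √(G_zu* G_zu / (G_yv G_yv*)) * |K H|`. -/
def MagnitudeCondition (Gyu H : RatFunc ℝ) (Gzu : Matrix (Fin nz) (Fin 1) (RatFunc ℝ))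
    (Gyv : Matrix (Fin 1) (Fin nv) (RatFunc ℝ)) (α : ℝ) (K : RatFunc ℝ)
    (C : Circle → ℂ) : Prop :=
  ∀ᵐ ζ ∂arcMeasure, ‖C ζ‖ ^ 2 =
    α / (loopNorm Gyu H Gzu Gyv K).toReal *
      √((((onCircle Gzu ζ)ᴴ * onCircle Gzu ζ) 0 0).re /
        ((onCircle Gyv ζ * (onCircle Gyv ζ)ᴴ) 0 0).re) *
      ‖evalAt K ζ * evalAt H ζ‖

end NetworkedControl

end

/-!
Write `s = |S|`, `h = |H|`, `a = G_zu* G_zu`, `b = G_yv G_yv*` on the circle. The power of the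
encoder is the integral of `x = |C|² s² b`, the cost is the integral of `y = |D|² s² h² a`, and since
`G_zu G_yv` has rank one its trace norm is `√(a b)` (`trace_sqrt_rankOne`), so that the norm `L` in
the bound is the integral of `u = |K| s² h √(a b)`. The constraint `D C = K` becomes `x y = u²`, and
the lower bound is the Cauchy–Schwarz inequality `L² ≤ (∫ x) (∫ y)`. In the equality case
`x = (α / L) u` almost everywhere (`ae_eq_of_lintegral_le`), which is the condition on `|C|²`.
Conversely every `C` with this modulus, paired with `D = K / C`, is feasible and attains the bound
(`feasible_and_cost_eq_of_magnitudeCondition`).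

It remains to realise the optimal modulus by an outer function. For an integrable `ℓ` on the circle
the exponential of its Herglotz integral is an outer function `F` with `|F| ≤ exp (ess sup ℓ)`. At every
point `ζ₀` with `ℓ ζ - ℓ ζ₀ = O(|ζ - ζ₀|)` the Herglotz kernel times `ℓ - ℓ ζ₀` is dominated along
the radius, so `F` has a radial limit, of modulus `exp (ℓ ζ₀)` because the kernel is purely imaginary
on the circle (`tendsto_outerFunction`, `norm_outerBoundary`). This replaces Fatou's theorem: the
fourth power of the optimal modulus is, almost everywhere, a constant times the modulus of the
rational function `a (K H)² / b`, whose logarithm is integrable on the circle and differentiable off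
finitely many points.
-/

namespace NetworkedControl

/-! ### The normalised arc length -/

lemma measurable_circleExp : Measurable (fun ω : ℝ => Circle.exp ω) :=
  Circle.exp.continuous.measurable

instance arcMeasure_isProbabilityMeasure : IsProbabilityMeasure arcMeasure := by
  constructor
  have h2 : (0 : ℝ) < 2 * Real.pi := by positivity
  rw [arcMeasure, Measure.smul_apply, Measure.map_apply measurable_circleExp MeasurableSet.univ]
  simp only [Set.preimage_univ, Measure.restrict_apply MeasurableSet.univ, Set.univ_inter,
    Real.volume_Ioc, smul_eq_mul]
  rw [← ENNReal.ofReal_mul (by positivity)]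
  rw [← ENNReal.ofReal_one]
  congr 1
  field_simp
  ring

instance arcMeasure_nullSingletonClass : NullSingletonClass arcMeasure := by
  constructor
  intro ζ
  rw [arcMeasure, Measure.smul_apply, Measure.map_apply measurable_circleExp
    (measurableSet_singleton ζ), Measure.restrict_apply
    (measurable_circleExp (measurableSet_singleton ζ))]
  have : ((fun ω : ℝ => Circle.exp ω) ⁻¹' {ζ} ∩ Set.Ioc (-Real.pi) Real.pi).Subsingleton := by
    rintro x ⟨hx, hx'⟩ y ⟨hy, hy'⟩
    simp only [Set.mem_preimage, Set.mem_singleton_iff] at hx hy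
    rw [← Circle.arg_exp hx'.1 hx'.2, ← Circle.arg_exp hy'.1 hy'.2, hx, hy]
  rw [this.measure_zero, smul_zero]

lemma continuous_circle_coe : Continuous (fun ζ : Circle => (ζ : ℂ)) :=
  continuous_subtype_val

/-- A property of complex numbers that fails only on a finite set holds almost everywhere on the
circle. -/
lemma ae_circle_of_finite {p : ℂ → Prop} (h : {z : ℂ | ¬ p z}.Finite) :
    ∀ᵐ ζ : Circle ∂arcMeasure, p ζ := by
  rw [ae_iff]
  have h' : {ζ : Circle | ¬ p ζ}.Finite := h.preimage Circle.coe_injective.injOn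
  exact h'.measure_zero _

lemma integrable_arcMeasure_of_circleIntegrable {E : Type*} [NormedAddCommGroup E] {f : ℂ → E}
    (hf : CircleIntegrable f 0 1)
    (hm : AEStronglyMeasurable (fun ζ : Circle => f ζ) arcMeasure) :
    Integrable (fun ζ : Circle => f ζ) arcMeasure := by
  have h2 : ENNReal.ofReal (1 / (2 * Real.pi)) ≠ 0 := by
    rw [ne_eq, ENNReal.ofReal_eq_zero, not_le]; positivity
  rw [arcMeasure] at hm ⊢
  have hm' : AEStronglyMeasurable (fun ζ : Circle => f ζ)
      ((volume.restrict (Set.Ioc (-Real.pi) Real.pi)).map (fun ω : ℝ => Circle.exp ω)) :=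
    hm.mono_ac (Measure.absolutelyContinuous_smul h2)
  refine Integrable.smul_measure ?_ ENNReal.ofReal_ne_top
  rw [integrable_map_measure hm' measurable_circleExp.aemeasurable]
  have h3 : IntervalIntegrable (fun θ : ℝ => f (circleMap 0 1 θ)) volume (-Real.pi) Real.pi :=
    ((periodic_circleMap (0 : ℂ) 1).comp f |>.intervalIntegrable₀ (by positivity) hf _ _)
  rw [intervalIntegrable_iff_integrableOn_Ioc_of_le (by linarith [Real.pi_pos])] at h3
  refine h3.congr (Eventually.of_forall fun θ => ?_)
  simp [circleMap]

lemma integral_arcMeasure_eq_circleAverage {f : ℂ → ℂ}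
    (hm : AEStronglyMeasurable (fun ζ : Circle => f ζ) arcMeasure) :
    ∫ ζ : Circle, f ζ ∂arcMeasure = Real.circleAverage f 0 1 := by
  have h2 : ENNReal.ofReal (1 / (2 * Real.pi)) ≠ 0 := by
    rw [ne_eq, ENNReal.ofReal_eq_zero, not_le]; positivity
  rw [arcMeasure] at hm ⊢
  have hm' : AEStronglyMeasurable (fun ζ : Circle => f ζ)
      ((volume.restrict (Set.Ioc (-Real.pi) Real.pi)).map (fun ω : ℝ => Circle.exp ω)) :=
    hm.mono_ac (Measure.absolutelyContinuous_smul h2)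
  rw [integral_smul_measure, integral_map measurable_circleExp.aemeasurable hm',
    Real.circleAverage, ENNReal.toReal_ofReal (by positivity),
    ← intervalIntegral.integral_of_le (by linarith [Real.pi_pos])]
  have := ((periodic_circleMap (0 : ℂ) 1).comp f).intervalIntegral_add_eq (-Real.pi) 0
  simp only [Function.comp_apply, zero_add] at this
  rw [show -Real.pi + 2 * Real.pi = Real.pi by ring] at this
  rw [← this, one_div]
  simp [circleMap]

/-! ### Outer functions with prescribed modulus -/

lemma coe_sub_coe_ne_zero {z : ℂ} (hz : 1 < ‖z‖) (ζ : Circle) : z - ζ ≠ 0 := by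
  intro h
  rw [sub_eq_zero.1 h, Circle.norm_coe] at hz
  exact lt_irrefl _ hz

lemma re_herglotz (z : ℂ) (ζ : Circle) :
    ((z + ζ) / (z - ζ)).re = (‖z‖ ^ 2 - 1) / ‖z - ζ‖ ^ 2 := by
  have h1 : (ζ : ℂ).re * (ζ : ℂ).re + (ζ : ℂ).im * (ζ : ℂ).im = 1 := by
    have := Circle.normSq_coe ζ
    rwa [Complex.normSq_apply] at this
  rw [Complex.div_re, ← Complex.normSq_eq_norm_sq, ← Complex.normSq_eq_norm_sq, ← add_div]
  congr 1
  simp only [Complex.normSq_apply, Complex.add_re, Complex.sub_re, Complex.add_im, Complex.sub_im]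
  linear_combination (-1 : ℝ) * h1

lemma continuous_herglotz {z : ℂ} (hz : 1 < ‖z‖) :
    Continuous fun ζ : Circle => (z + ζ) / (z - ζ) :=
  (continuous_const.add continuous_circle_coe).div
    (continuous_const.sub continuous_circle_coe) (coe_sub_coe_ne_zero hz)

lemma norm_herglotz_le {z : ℂ} (hz : 1 < ‖z‖) (ζ : Circle) :
    ‖(z + ζ) / (z - ζ)‖ ≤ (‖z‖ + 1) / (‖z‖ - 1) := by
  rw [norm_div]
  have h1 : ‖z + ζ‖ ≤ ‖z‖ + 1 := by simpa [Circle.norm_coe] using norm_add_le z (ζ : ℂ)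
  have h2 : ‖z‖ - 1 ≤ ‖z - ζ‖ := by
    simpa [Circle.norm_coe] using norm_sub_norm_le z (ζ : ℂ)
  have h3 : 0 < ‖z‖ - 1 := by linarith
  gcongr

lemma integrable_herglotz_mul {z : ℂ} (hz : 1 < ‖z‖) {g : Circle → ℂ}
    (hg : Integrable g arcMeasure) :
    Integrable (fun ζ : Circle => (z + ζ) / (z - ζ) * g ζ) arcMeasure :=
  hg.bdd_mul (continuous_herglotz hz).measurable.aestronglyMeasurable
    (Eventually.of_forall (norm_herglotz_le hz))

/-- The Herglotz kernel has mean `1` on the circle. -/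
lemma integral_herglotz {z : ℂ} (hz : 1 < ‖z‖) :
    ∫ ζ : Circle, (z + ζ) / (z - ζ) ∂arcMeasure = 1 := by
  have hz0 : z ≠ 0 := by rintro rfl; simp at hz; linarith
  rw [integral_arcMeasure_eq_circleAverage (f := fun w => (z + w) / (z - w))
    (continuous_herglotz hz).measurable.aestronglyMeasurable]
  rw [DiffContOnCl.circleAverage (f := fun w => (z + w) / (z - w))]
  · simp [hz0]
  · apply DifferentiableOn.diffContOnCl
    intro w hw
    have hw : ‖w‖ ≤ 1 := by
      simpa using Metric.closure_ball_subset_closedBall hw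
    have : z - w ≠ 0 := by
      intro h
      rw [sub_eq_zero.1 h] at hz
      linarith
    apply DifferentiableAt.differentiableWithinAt
    fun_prop (disch := assumption)

/-- The exponential of the Herglotz integral of `ℓ` on the exterior of the disc: the outer function
with `log |F| = ℓ` on the circle. -/
noncomputable def outerFunction (ℓ : Circle → ℝ) (z : ℂ) : ℂ :=
  Complex.exp (∫ ζ : Circle, (z + (ζ : ℂ)) / (z - (ζ : ℂ)) * ((ℓ ζ : ℝ) : ℂ) ∂arcMeasure)

lemma norm_outerFunction_le {ℓ : Circle → ℝ} (hℓ : Integrable ℓ arcMeasure) {B : ℝ}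
    (hB : ∀ᵐ ζ ∂arcMeasure, ℓ ζ ≤ B) {z : ℂ} (hz : 1 < ‖z‖) :
    ‖outerFunction ℓ z‖ ≤ Real.exp B := by
  rw [outerFunction, Complex.norm_exp]
  apply Real.exp_le_exp.2
  have h1 := integrable_herglotz_mul hz hℓ.ofReal
  have h2 := integrable_herglotz_mul hz (integrable_const (1 : ℂ) (μ := arcMeasure))
  simp only [mul_one] at h2
  have h3 := integral_re h1
  have h4 := integral_re h2
  simp only [RCLike.re_to_complex, RCLike.ofReal_eq_complex_ofReal] at h3 h4
  rw [← h3]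
  rw [integral_herglotz hz] at h4
  calc _ ≤ ∫ ζ : Circle, ((z + ζ) / (z - ζ)).re * B ∂arcMeasure := by
        apply integral_mono_ae h1.re (h2.re.mul_const B)
        filter_upwards [hB] with ζ hζ
        simp only [RCLike.re_to_complex, RCLike.ofReal_eq_complex_ofReal, Complex.re_mul_ofReal]
        apply mul_le_mul_of_nonneg_left hζ
        rw [re_herglotz]
        have : 1 ≤ ‖z‖ ^ 2 := one_le_pow₀ hz.le
        apply div_nonneg <;> [linarith; positivity]
    _ = B := by rw [integral_mul_const, h4]; simp

lemma exists_differentiableOn_outerFunction {ℓ : Circle → ℝ} (hℓ : Integrable ℓ arcMeasure) :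
    ∃ f : ℂ → ℂ, DifferentiableOn ℂ f (Metric.ball 0 1) ∧
      ∀ z : ℂ, 1 < ‖z‖ → outerFunction ℓ z = f z⁻¹ := by
  -- In the variable `w = z⁻¹` the kernel is `(1 + w ζ) / (1 - w ζ)`, analytic on the unit disc.
  have hne : ∀ w : ℂ, ‖w‖ < 1 → ∀ ζ : Circle, 1 - ‖w‖ ≤ ‖1 - w * ζ‖ := by
    intro w hw ζ
    have := norm_sub_norm_le (1 : ℂ) (w * ζ)
    simpa [Circle.norm_coe] using this
  refine ⟨fun w => Complex.exp
    (∫ ζ : Circle, (1 + w * ζ) / (1 - w * ζ) * ((ℓ ζ : ℝ) : ℂ) ∂arcMeasure), ?_, ?_⟩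
  · intro w₀ hw₀
    have hw₀ : ‖w₀‖ < 1 := by simpa using hw₀
    obtain ⟨ρ, hρ, hρ1⟩ := exists_between hw₀
    have hcont : ∀ w : ℂ, ‖w‖ < 1 → Continuous fun ζ : Circle => (1 + w * ζ) / (1 - w * ζ) := by
      intro w hw
      refine Continuous.div (by fun_prop) (by fun_prop) fun ζ h => ?_
      have := hne w hw ζ
      rw [h, norm_zero] at this
      linarith
    have hmem : Metric.ball (0 : ℂ) ρ ∈ 𝓝 w₀ := Metric.isOpen_ball.mem_nhds (by simpa using hρ)
    have key := hasDerivAt_integral_of_dominated_loc_of_deriv_le (μ := arcMeasure) (𝕜 := ℂ)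
      (F := fun w (ζ : Circle) => (1 + w * ζ) / (1 - w * ζ) * ((ℓ ζ : ℝ) : ℂ))
      (F' := fun w (ζ : Circle) => 2 * (ζ : ℂ) / (1 - w * ζ) ^ 2 * ((ℓ ζ : ℝ) : ℂ))
      (x₀ := w₀) (bound := fun ζ => 2 / (1 - ρ) ^ 2 * ‖ℓ ζ‖) hmem ?_ ?_ ?_ ?_ ?_ ?_
    · exact key.2.differentiableAt.cexp.differentiableWithinAt
    · filter_upwards [hmem] with w hw
      have hw : ‖w‖ < ρ := by simpa using hw
      exact (hcont w (hw.trans hρ1)).measurable.aestronglyMeasurable.mul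
        hℓ.ofReal.aestronglyMeasurable
    · refine hℓ.ofReal.bdd_mul (c := 2 / (1 - ‖w₀‖))
        (hcont w₀ hw₀).measurable.aestronglyMeasurable (Eventually.of_forall fun ζ => ?_)
      rw [norm_div]
      have h1 : ‖1 + w₀ * ζ‖ ≤ 2 := by
        have := norm_add_le (1 : ℂ) (w₀ * ζ)
        simp only [norm_mul, norm_one, Circle.norm_coe, mul_one] at this; linarith
      have h2 := hne w₀ hw₀ ζ
      have h3 : 0 < 1 - ‖w₀‖ := by linarith
      gcongr
    · refine AEStronglyMeasurable.mul ?_ hℓ.ofReal.aestronglyMeasurable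
      refine (Continuous.div (by fun_prop) (by fun_prop) fun ζ h => ?_).measurable.aestronglyMeasurable
      have := hne w₀ hw₀ ζ
      rw [pow_eq_zero_iff (by norm_num)] at h
      rw [h, norm_zero] at this
      linarith
    · refine Eventually.of_forall fun ζ w hw => ?_
      have hw : ‖w‖ < ρ := by simpa using hw
      have h2 := hne w (hw.trans hρ1) ζ
      have h3 : 0 < 1 - ρ := by linarith
      rw [norm_mul, norm_div, norm_pow, norm_mul, Circle.norm_coe, Complex.norm_real]
      have h4 : 1 - ρ ≤ ‖1 - w * ζ‖ := by linarith
      simp only [Complex.norm_ofNat, mul_one]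
      gcongr
    · exact hℓ.norm.const_mul _
    · refine Eventually.of_forall fun ζ w hw => ?_
      have hw : ‖w‖ < ρ := by simpa using hw
      have h0 : 1 - w * (ζ : ℂ) ≠ 0 := by
        intro h
        have := hne w (hw.trans hρ1) ζ
        rw [h, norm_zero] at this
        linarith
      have hd1 : HasDerivAt (fun w : ℂ => 1 + w * (ζ : ℂ)) (ζ : ℂ) w := by
        simpa using ((hasDerivAt_id w).mul_const (ζ : ℂ)).const_add 1
      have hd2 : HasDerivAt (fun w : ℂ => 1 - w * (ζ : ℂ)) (-(ζ : ℂ)) w := by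
        simpa using ((hasDerivAt_id w).mul_const (ζ : ℂ)).const_sub 1
      refine ((hd1.fun_div hd2 h0).mul_const ((ℓ ζ : ℝ) : ℂ)).congr_deriv ?_
      congr 2
      ring
  · intro z hz
    have hz0 : z ≠ 0 := by rintro rfl; simp at hz; linarith
    simp only [outerFunction]
    congr 1
    refine integral_congr_ae (Eventually.of_forall fun ζ => ?_)
    have h0 := coe_sub_coe_ne_zero hz ζ
    have h1 : 1 - z⁻¹ * (ζ : ℂ) ≠ 0 := by
      intro h
      apply h0
      have : z - ζ = z * (1 - z⁻¹ * (ζ : ℂ)) := by field_simp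
      rw [this, h, mul_zero]
    simp only
    congr 1
    rw [div_eq_div_iff h0 h1]
    field_simp

lemma isH2_outerFunction {ℓ : Circle → ℝ} (hℓ : Integrable ℓ arcMeasure) {B : ℝ}
    (hB : ∀ᵐ ζ ∂arcMeasure, ℓ ζ ≤ B) : IsH2 (outerFunction ℓ) := by
  refine ⟨exists_differentiableOn_outerFunction hℓ, ?_⟩
  refine lt_of_le_of_lt (b := ENNReal.ofReal (Real.exp B)) (iSup_le fun r => ?_)
    ENNReal.ofReal_lt_top
  refine (eLpNorm_le_of_ae_bound (C := Real.exp B) (Eventually.of_forall fun ζ => ?_)).trans ?_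
  · apply norm_outerFunction_le hℓ hB
    have := r.2
    simp only [norm_mul, Circle.norm_coe, mul_one, Complex.norm_real, Real.norm_eq_abs]
    exact this.trans_le (le_abs_self _)
  · simp

lemma isOuter_outerFunction {ℓ : Circle → ℝ} (hm : Measurable ℓ) (hℓ : Integrable ℓ arcMeasure) :
    IsOuter (outerFunction ℓ) :=
  ⟨1, fun ζ => Real.exp (ℓ ζ), by simp, hm.exp, fun ζ => Real.exp_pos _, by simpa using hℓ,
    fun z _ => by simp [outerFunction]⟩

/-- The radial boundary value of `outerFunction ℓ` at a point where `ℓ` is locally Lipschitz. -/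
noncomputable def outerBoundary (ℓ : Circle → ℝ) (ζ₀ : Circle) : ℂ :=
  Complex.exp ((ℓ ζ₀ : ℝ) +
    ∫ ζ : Circle, ((ζ₀ : ℂ) + ζ) / (ζ₀ - ζ) * (((ℓ ζ - ℓ ζ₀ : ℝ)) : ℂ) ∂arcMeasure)

/-- If `|ℓ ζ - ℓ ζ₀| = O(|ζ - ζ₀|)`, then `(ℓ - ℓ ζ₀)` times the Herglotz kernel is dominated
uniformly along the radius through `ζ₀`, so that the Herglotz integral converges radially. -/
lemma tendsto_outerFunction {ℓ : Circle → ℝ} (hℓ : Integrable ℓ arcMeasure) {ζ₀ : Circle}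
    (hO : (fun ζ : Circle => ℓ ζ - ℓ ζ₀) =O[𝓝 ζ₀] fun ζ : Circle => (ζ : ℂ) - ζ₀) :
    Tendsto (fun r : ℝ => outerFunction ℓ ((r : ℂ) * (ζ₀ : ℂ))) (𝓝[>] 1)
      (𝓝 (outerBoundary ℓ ζ₀)) := by
  obtain ⟨M, hM0, hM⟩ := hO.exists_pos
  obtain ⟨δ, hδ, hball⟩ := Metric.eventually_nhds_iff.1 hM.bound
  have hnorm : ∀ r : ℝ, 1 < r → ‖(r : ℂ) * (ζ₀ : ℂ)‖ = r := by
    intro r hr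
    rw [norm_mul, Circle.norm_coe, mul_one, Complex.norm_real, Real.norm_eq_abs,
      abs_of_pos (zero_lt_one.trans hr)]
  have hsplit : ∀ r : ℝ, 1 < r → outerFunction ℓ ((r : ℂ) * (ζ₀ : ℂ)) =
      Complex.exp ((ℓ ζ₀ : ℝ) + ∫ ζ : Circle, ((r : ℂ) * (ζ₀ : ℂ) + ζ) / ((r : ℂ) * (ζ₀ : ℂ) - ζ) *
        (((ℓ ζ - ℓ ζ₀ : ℝ)) : ℂ) ∂arcMeasure) := by
    intro r hr
    have hz : 1 < ‖(r : ℂ) * (ζ₀ : ℂ)‖ := by rwa [hnorm r hr]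
    rw [outerFunction]
    congr 1
    simp only [Complex.ofReal_sub, mul_sub]
    have h1 := integral_sub (integrable_herglotz_mul hz hℓ.ofReal)
      (integrable_herglotz_mul hz (integrable_const (μ := arcMeasure) ((ℓ ζ₀ : ℝ) : ℂ)))
    rw [integral_mul_const, integral_herglotz hz, one_mul] at h1
    exact (add_eq_of_eq_sub' h1).symm
  have hev : ∀ᶠ r : ℝ in 𝓝[>] 1, 1 < r ∧ r < 2 :=
    Ioo_mem_nhdsGT (by norm_num : (1 : ℝ) < 2)
  refine Tendsto.congr' (f₁ := fun r : ℝ => Complex.exp ((ℓ ζ₀ : ℝ) + ∫ ζ : Circle,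
    ((r : ℂ) * (ζ₀ : ℂ) + ζ) / ((r : ℂ) * (ζ₀ : ℂ) - ζ) * (((ℓ ζ - ℓ ζ₀ : ℝ)) : ℂ) ∂arcMeasure))
    (hev.mono fun r hr => (hsplit r hr.1).symm) ?_
  refine (Complex.continuous_exp.tendsto _).comp (Tendsto.const_add _ ?_)
  refine tendsto_integral_filter_of_dominated_convergence
    (fun ζ => 6 * M + 6 / δ * (‖ℓ ζ‖ + ‖ℓ ζ₀‖)) ?_ ?_ ?_ ?_
  · filter_upwards [hev] with r hr
    exact (integrable_herglotz_mul (by rw [hnorm r hr.1]; exact hr.1)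
      (hℓ.sub (integrable_const (ℓ ζ₀))).ofReal).aestronglyMeasurable
  · filter_upwards [hev] with r hr
    refine Eventually.of_forall fun ζ => ?_
    have hz : 1 < ‖(r : ℂ) * (ζ₀ : ℂ)‖ := by rw [hnorm r hr.1]; exact hr.1
    -- On the ray, `|ζ - ζ₀| ≤ 2 |r ζ₀ - ζ|`, since `r - 1 ≤ |r ζ₀ - ζ|`.
    have h1 : r - 1 ≤ ‖(r : ℂ) * (ζ₀ : ℂ) - ζ‖ := by
      have := norm_sub_norm_le ((r : ℂ) * (ζ₀ : ℂ)) (ζ : ℂ)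
      rwa [hnorm r hr.1, Circle.norm_coe] at this
    have h2 : ‖(ζ : ℂ) - ζ₀‖ ≤ 2 * ‖(r : ℂ) * (ζ₀ : ℂ) - ζ‖ := by
      have h3 : (ζ : ℂ) - ζ₀ = -((r : ℂ) * (ζ₀ : ℂ) - ζ) + ((r - 1 : ℝ) : ℂ) * ζ₀ := by
        push_cast; ring
      have h4 := norm_add_le (-((r : ℂ) * (ζ₀ : ℂ) - ζ)) (((r - 1 : ℝ) : ℂ) * ζ₀)
      rw [← h3, norm_neg, norm_mul, Circle.norm_coe, Complex.norm_real, Real.norm_eq_abs,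
        abs_of_pos (by linarith [hr.1])] at h4
      linarith
    have h5 : ‖(r : ℂ) * (ζ₀ : ℂ) + ζ‖ ≤ 3 := by
      have := norm_add_le ((r : ℂ) * (ζ₀ : ℂ)) (ζ : ℂ)
      rw [hnorm r hr.1, Circle.norm_coe] at this
      linarith [hr.2]
    have h6 : 0 < ‖(r : ℂ) * (ζ₀ : ℂ) - ζ‖ := by linarith [hr.1]
    rw [norm_mul, norm_div, Complex.norm_real, div_mul_eq_mul_div, div_le_iff₀ h6]
    have h7 : 0 ≤ ‖ℓ ζ‖ + ‖ℓ ζ₀‖ := by positivity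
    have h8 : ‖ℓ ζ - ℓ ζ₀‖ ≤ ‖ℓ ζ‖ + ‖ℓ ζ₀‖ := norm_sub_le _ _
    have h9 : ‖(r : ℂ) * (ζ₀ : ℂ) + ζ‖ * ‖ℓ ζ - ℓ ζ₀‖ ≤ 3 * ‖ℓ ζ - ℓ ζ₀‖ := by gcongr
    rcases lt_or_ge (dist ζ ζ₀) δ with hd | hd
    · have h10 := hball hd
      have h11 : 0 ≤ 6 / δ * (‖ℓ ζ‖ + ‖ℓ ζ₀‖) := by positivity
      nlinarith
    · have h12 : dist ζ ζ₀ = ‖(ζ : ℂ) - ζ₀‖ := by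
        exact dist_eq_norm (ζ : ℂ) (ζ₀ : ℂ)
      rw [h12] at hd
      have h13 : 3 ≤ 6 / δ * ‖(r : ℂ) * (ζ₀ : ℂ) - ζ‖ := by
        rw [div_mul_eq_mul_div, le_div_iff₀ hδ]
        linarith
      calc _ ≤ 3 * ‖ℓ ζ - ℓ ζ₀‖ := h9
        _ ≤ 3 * (‖ℓ ζ‖ + ‖ℓ ζ₀‖) := by gcongr
        _ ≤ 6 / δ * ‖(r : ℂ) * (ζ₀ : ℂ) - ζ‖ * (‖ℓ ζ‖ + ‖ℓ ζ₀‖) := by gcongr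
        _ ≤ _ := by
          have : 0 ≤ 6 * M * ‖(r : ℂ) * (ζ₀ : ℂ) - ζ‖ := by positivity
          linarith
  · exact (integrable_const _).add ((hℓ.norm.add (integrable_const _)).const_mul _)
  · refine Eventually.of_forall fun ζ => ?_
    by_cases hζ : ζ = ζ₀
    · subst hζ
      simp
    · have hne : (ζ₀ : ℂ) - ζ ≠ 0 := by
        rw [sub_ne_zero]
        exact fun h => hζ (Circle.coe_injective h).symm
      refine Tendsto.mul_const _ ?_
      have : ContinuousAt (fun r : ℝ => ((r : ℂ) * (ζ₀ : ℂ) + ζ) / ((r : ℂ) * (ζ₀ : ℂ) - ζ)) 1 := by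
        refine ContinuousAt.div (by fun_prop) (by fun_prop) (by simpa using hne)
      have h := this.tendsto
      simp only [Complex.ofReal_one, one_mul] at h
      exact h.mono_left nhdsWithin_le_nhds

/-- The Herglotz kernel is purely imaginary on the circle, so the integral in `outerBoundary`
contributes only a phase; where that integral diverges, Lean's value `0` for it does the same. -/
lemma norm_outerBoundary (ℓ : Circle → ℝ) (ζ₀ : Circle) :
    ‖outerBoundary ℓ ζ₀‖ = Real.exp (ℓ ζ₀) := by
  rw [outerBoundary, Complex.norm_exp, Complex.add_re, Complex.ofReal_re]
  congr 1
  rw [add_eq_left]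
  by_cases h : Integrable (fun ζ : Circle => ((ζ₀ : ℂ) + ζ) / (ζ₀ - ζ) *
      (((ℓ ζ - ℓ ζ₀ : ℝ)) : ℂ)) arcMeasure
  · have h1 := integral_re h
    simp only [RCLike.re_to_complex, Complex.re_mul_ofReal] at h1
    rw [← h1]
    refine integral_eq_zero_of_ae (Eventually.of_forall fun ζ => ?_)
    simp only [Pi.zero_apply]
    rw [re_herglotz, Circle.norm_coe]
    simp
  · rw [integral_undef h, Complex.zero_re]

lemma aemeasurable_outerBoundary {ℓ : Circle → ℝ} (hℓ : Integrable ℓ arcMeasure)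
    (hO : ∀ᵐ ζ₀ ∂arcMeasure,
      (fun ζ : Circle => ℓ ζ - ℓ ζ₀) =O[𝓝 ζ₀] fun ζ : Circle => (ζ : ℂ) - ζ₀) :
    AEMeasurable (outerBoundary ℓ) arcMeasure := by
  obtain ⟨f, hf, hfF⟩ := exists_differentiableOn_outerFunction hℓ
  have hr : ∀ n : ℕ, (1 : ℝ) < 1 + 1 / ((n : ℝ) + 1) := fun n => by
    have : (0 : ℝ) < 1 / ((n : ℝ) + 1) := by positivity
    linarith
  have hlim : Tendsto (fun n : ℕ => 1 + 1 / ((n : ℝ) + 1)) atTop (𝓝[>] 1) := by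
    refine tendsto_nhdsWithin_iff.2 ⟨?_, Eventually.of_forall hr⟩
    simpa using tendsto_one_div_add_atTop_nhds_zero_nat.const_add (1 : ℝ)
  refine aemeasurable_of_tendsto_metrizable_ae (u := atTop)
    (f := fun (n : ℕ) (ζ : Circle) =>
      outerFunction ℓ (((1 + 1 / ((n : ℝ) + 1) : ℝ) : ℂ) * (ζ : ℂ))) (fun n => ?_) ?_
  · have hn : ∀ ζ : Circle, ‖((1 + 1 / ((n : ℝ) + 1) : ℝ) : ℂ) * (ζ : ℂ)‖ =
        1 + 1 / ((n : ℝ) + 1) := fun ζ => by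
      rw [norm_mul, Circle.norm_coe, mul_one, Complex.norm_real, Real.norm_eq_abs,
        abs_of_pos (zero_lt_one.trans (hr n))]
    have : (fun ζ : Circle => outerFunction ℓ (((1 + 1 / ((n : ℝ) + 1) : ℝ) : ℂ) * (ζ : ℂ))) =
        fun ζ : Circle => f (((1 + 1 / ((n : ℝ) + 1) : ℝ) : ℂ) * (ζ : ℂ))⁻¹ := by
      funext ζ
      exact hfF _ (by rw [hn]; exact hr n)
    rw [this]
    refine Continuous.aemeasurable ?_
    refine hf.continuousOn.comp_continuous (Continuous.inv₀ (by fun_prop) fun ζ h => ?_) fun ζ => ?_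
    · have := hn ζ
      rw [h, norm_zero] at this
      linarith [hr n]
    · rw [mem_ball_zero_iff, norm_inv, hn]
      exact inv_lt_one_of_one_lt₀ (hr n)
  · filter_upwards [hO] with ζ hζ
    exact (tendsto_outerFunction hℓ hζ).comp hlim

/-- A log-integrable modulus that is bounded and whose logarithm is Lipschitz at almost every point
is the boundary modulus of an outer function in `H²`. -/
theorem isOuterH2_outerBoundary {ℓ : Circle → ℝ} (hm : Measurable ℓ)
    (hℓ : Integrable ℓ arcMeasure) {B : ℝ} (hB : ∀ᵐ ζ ∂arcMeasure, ℓ ζ ≤ B)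
    (hO : ∀ᵐ ζ₀ ∂arcMeasure,
      (fun ζ : Circle => ℓ ζ - ℓ ζ₀) =O[𝓝 ζ₀] fun ζ : Circle => (ζ : ℂ) - ζ₀) :
    IsOuterH2 (outerBoundary ℓ) :=
  ⟨outerFunction ℓ, isH2_outerFunction hℓ hB, isOuter_outerFunction hm hℓ,
    hO.mono fun _ h => tendsto_outerFunction hℓ h⟩

end NetworkedControl

namespace NetworkedControl

/-! ### Boundary values of rational functions -/

lemma evalAt_eq (K : RatFunc ℝ) (z : ℂ) :
    evalAt K z = Polynomial.aeval z K.num / Polynomial.aeval z K.denom := rfl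

lemma ae_aeval_ne_zero {p : Polynomial ℝ} (hp : p ≠ 0) :
    ∀ᵐ ζ : Circle ∂arcMeasure, Polynomial.aeval (ζ : ℂ) p ≠ 0 := by
  refine ae_circle_of_finite (p := fun z : ℂ => Polynomial.aeval z p ≠ 0) ?_
  refine (p.rootSet_finite ℂ).subset fun z hz => ?_
  simp only [Set.mem_ofPred_eq, not_not] at hz
  exact (Polynomial.mem_rootSet_of_ne hp).2 hz

lemma ae_evalAt_ne_zero {K : RatFunc ℝ} (hK : K ≠ 0) :
    ∀ᵐ ζ : Circle ∂arcMeasure, evalAt K ζ ≠ 0 := by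
  filter_upwards [ae_aeval_ne_zero (RatFunc.num_ne_zero hK), ae_aeval_ne_zero K.denom_ne_zero]
    with ζ h1 h2
  exact div_ne_zero h1 h2

lemma evalAt_zero (z : ℂ) : evalAt 0 z = 0 := RatFunc.eval_zero _ _

lemma evalAt_one (z : ℂ) : evalAt 1 z = 1 := RatFunc.eval_one _ _

lemma ae_evalAt_mul (K L : RatFunc ℝ) :
    ∀ᵐ ζ : Circle ∂arcMeasure, evalAt (K * L) ζ = evalAt K ζ * evalAt L ζ := by
  filter_upwards [ae_aeval_ne_zero K.denom_ne_zero, ae_aeval_ne_zero L.denom_ne_zero] with ζ h1 h2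
  exact RatFunc.eval_mul _ _ h1 h2

lemma ae_evalAt_add (K L : RatFunc ℝ) :
    ∀ᵐ ζ : Circle ∂arcMeasure, evalAt (K + L) ζ = evalAt K ζ + evalAt L ζ := by
  filter_upwards [ae_aeval_ne_zero K.denom_ne_zero, ae_aeval_ne_zero L.denom_ne_zero] with ζ h1 h2
  exact RatFunc.eval_add _ _ h1 h2

lemma ae_evalAt_sum {ι : Type*} (s : Finset ι) (K : ι → RatFunc ℝ) :
    ∀ᵐ ζ : Circle ∂arcMeasure, evalAt (∑ i ∈ s, K i) ζ = ∑ i ∈ s, evalAt (K i) ζ := by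
  classical
  induction s using Finset.induction_on with
  | empty => exact Eventually.of_forall fun ζ => by simp [evalAt_zero]
  | insert i s hi ih =>
    rw [Finset.sum_insert hi]
    filter_upwards [ih, ae_evalAt_add (K i) (∑ j ∈ s, K j)] with ζ h1 h2
    rw [h2, h1, Finset.sum_insert hi]

lemma ae_evalAt_inv (K : RatFunc ℝ) :
    ∀ᵐ ζ : Circle ∂arcMeasure, evalAt K⁻¹ ζ = (evalAt K ζ)⁻¹ := by
  rcases eq_or_ne K 0 with rfl | hK
  · exact Eventually.of_forall fun ζ => by simp [evalAt_zero]
  · filter_upwards [ae_evalAt_mul K⁻¹ K, ae_evalAt_ne_zero hK] with ζ h1 h2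
    rw [inv_mul_cancel₀ hK, evalAt_one] at h1
    exact eq_inv_of_mul_eq_one_left h1.symm

lemma ae_evalAt_div (K L : RatFunc ℝ) :
    ∀ᵐ ζ : Circle ∂arcMeasure, evalAt (K / L) ζ = evalAt K ζ / evalAt L ζ := by
  filter_upwards [ae_evalAt_mul K L⁻¹, ae_evalAt_inv L] with ζ h1 h2
  rw [div_eq_mul_inv, h1, h2, div_eq_mul_inv]

lemma ae_evalAt_pow (K : RatFunc ℝ) (n : ℕ) :
    ∀ᵐ ζ : Circle ∂arcMeasure, evalAt (K ^ n) ζ = evalAt K ζ ^ n := by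
  induction n with
  | zero => exact Eventually.of_forall fun ζ => by simp [evalAt_one]
  | succ n ih =>
    filter_upwards [ih, ae_evalAt_mul (K ^ n) K] with ζ h1 h2
    rw [pow_succ, h2, h1, pow_succ]

lemma evalAt_C (a : ℝ) (z : ℂ) : evalAt (RatFunc.C a) z = a := RatFunc.eval_C _ _

lemma evalAt_X (z : ℂ) : evalAt RatFunc.X z = z := RatFunc.eval_X _ _

lemma conj_coe_eq_inv (ζ : Circle) : (starRingEnd ℂ) (ζ : ℂ) = (ζ : ℂ)⁻¹ := by
  rw [← Circle.coe_inv_eq_conj, Circle.coe_inv]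

lemma ae_evalAt_eval₂ (p : Polynomial ℝ) :
    ∀ᵐ ζ : Circle ∂arcMeasure, evalAt (p.eval₂ RatFunc.C (RatFunc.X)⁻¹) ζ =
      (starRingEnd ℂ) (Polynomial.aeval (ζ : ℂ) p) := by
  induction p using Polynomial.induction_on' with
  | add p q hp hq =>
    filter_upwards [hp, hq, ae_evalAt_add (p.eval₂ RatFunc.C (RatFunc.X)⁻¹)
      (q.eval₂ RatFunc.C (RatFunc.X)⁻¹)] with ζ h1 h2 h3
    rw [Polynomial.eval₂_add, h3, h1, h2, map_add, map_add]
  | monomial n a =>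
    filter_upwards [ae_evalAt_mul (RatFunc.C a) ((RatFunc.X)⁻¹ ^ n),
      ae_evalAt_pow (RatFunc.X)⁻¹ n, ae_evalAt_inv RatFunc.X] with ζ h1 h2 h3
    rw [Polynomial.eval₂_monomial, h1, h2, h3, evalAt_C, evalAt_X, Polynomial.aeval_monomial,
      map_mul, map_pow, conj_coe_eq_inv]
    simp

lemma ae_evalAt_eval_inv (K : RatFunc ℝ) :
    ∀ᵐ ζ : Circle ∂arcMeasure, evalAt (K.eval RatFunc.C (RatFunc.X)⁻¹) ζ =
      (starRingEnd ℂ) (evalAt K ζ) := by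
  filter_upwards [ae_evalAt_eval₂ K.num, ae_evalAt_eval₂ K.denom,
    ae_evalAt_div (K.num.eval₂ RatFunc.C (RatFunc.X)⁻¹) (K.denom.eval₂ RatFunc.C (RatFunc.X)⁻¹)]
    with ζ h1 h2 h3
  rw [RatFunc.eval, h3, h1, h2, evalAt_eq, map_div₀]

lemma measurable_evalAt (K : RatFunc ℝ) : Measurable (fun ζ : Circle => evalAt K ζ) := by
  have h : ∀ p : Polynomial ℝ, Measurable (fun ζ : Circle => Polynomial.aeval (ζ : ℂ) p) :=
    fun p => (p.continuous_aeval.comp continuous_circle_coe).measurable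
  exact (h K.num).div (h K.denom)

lemma continuous_evalAt {K : RatFunc ℝ} (hK : ∀ ζ : Circle, ¬ HasPole K ζ) :
    Continuous (fun ζ : Circle => evalAt K ζ) :=
  (K.num.continuous_aeval.comp continuous_circle_coe).div
    (K.denom.continuous_aeval.comp continuous_circle_coe) hK

lemma exists_norm_evalAt_le {K : RatFunc ℝ} (hK : ∀ ζ : Circle, ¬ HasPole K ζ) :
    ∃ B : ℝ, 0 < B ∧ ∀ ζ : Circle, ‖evalAt K ζ‖ ≤ B := by
  obtain ⟨B, hB⟩ := isCompact_univ.exists_bound_of_continuousOn (continuous_evalAt hK).continuousOn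
  exact ⟨max B 1, by positivity, fun ζ => (hB ζ (Set.mem_univ _)).trans (le_max_left _ _)⟩

lemma exists_le_norm_evalAt {K : RatFunc ℝ} (hK : ∀ ζ : Circle, ¬ HasPole K ζ)
    (hK' : ∀ ζ : Circle, ¬ HasZero K ζ) :
    ∃ m : ℝ, 0 < m ∧ ∀ ζ : Circle, m ≤ ‖evalAt K ζ‖ := by
  obtain ⟨ζ₀, -, h⟩ := isCompact_univ.exists_isMinOn (Set.univ_nonempty (α := Circle))
    (continuous_evalAt hK).norm.continuousOn
  exact ⟨‖evalAt K ζ₀‖, norm_pos_iff.2 (div_ne_zero (hK' ζ₀) (hK ζ₀)),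
    fun ζ => h (Set.mem_univ ζ)⟩

lemma ne_zero_of_not_hasZero {K : RatFunc ℝ} (hK : ∀ ζ : Circle, ¬ HasZero K ζ) : K ≠ 0 := by
  rintro rfl
  exact hK 1 (by simp [HasZero])

lemma integrable_log_norm_evalAt (K : RatFunc ℝ) :
    Integrable (fun ζ : Circle => Real.log ‖evalAt K ζ‖) arcMeasure := by
  refine integrable_arcMeasure_of_circleIntegrable (f := fun z => Real.log ‖evalAt K z‖) ?_
    (measurable_evalAt K).norm.log.aestronglyMeasurable
  refine MeromorphicOn.circleIntegrable_log_norm fun z _ => ?_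
  exact (AnalyticAt.aeval_polynomial analyticAt_id K.num).meromorphicAt.div
    (AnalyticAt.aeval_polynomial analyticAt_id K.denom).meromorphicAt

lemma ae_isBigO_log_norm_evalAt {K : RatFunc ℝ} (hK : K ≠ 0) :
    ∀ᵐ ζ₀ : Circle ∂arcMeasure,
      (fun ζ : Circle => Real.log ‖evalAt K ζ‖ - Real.log ‖evalAt K ζ₀‖) =O[𝓝 ζ₀]
        fun ζ : Circle => (ζ : ℂ) - ζ₀ := by
  filter_upwards [ae_aeval_ne_zero K.denom_ne_zero, ae_evalAt_ne_zero hK] with ζ₀ h1 h2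
  have hd : DifferentiableAt ℂ (fun z => evalAt K z) (ζ₀ : ℂ) :=
    K.num.differentiable_aeval.differentiableAt.div
      K.denom.differentiable_aeval.differentiableAt h1
  have hd' : DifferentiableAt ℝ (fun z => Real.log ‖evalAt K z‖) (ζ₀ : ℂ) :=
    ((hd.restrictScalars ℝ).norm ℝ h2).log (norm_ne_zero_iff.2 h2)
  exact hd'.isBigO_sub.comp_tendsto continuous_circle_coe.continuousAt

/-- The sensitivity function does not vanish identically: if it did, then `K G = 1`, although `K` is
proper and `G` strictly proper. -/
lemma sens_ne_zero {G K : RatFunc ℝ} (hG : IsStrictlyProper G) (hK : IsProper K) :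
    sens G K ≠ 0 := by
  rw [sens, one_div]
  refine inv_ne_zero (sub_ne_zero.2 ?_)
  intro h
  have h1 := RatFunc.num_denom_mul K G
  rw [← h, RatFunc.num_one, RatFunc.denom_one, one_mul, mul_one] at h1
  have h2 := congrArg Polynomial.degree h1
  rw [Polynomial.degree_mul, Polynomial.degree_mul] at h2
  have h3 : K.num.degree + G.num.degree < K.denom.degree + G.denom.degree := by
    refine (add_le_add_left hK _).trans_lt ?_
    refine WithBot.add_lt_add_left ?_ hG
    rw [ne_eq, Polynomial.degree_eq_bot]
    exact K.denom_ne_zero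
  exact h3.ne' h2

/-! ### Frobenius norms and the trace norm of rank-one matrices -/

/-- The squared Frobenius norm `‖X‖_F²`. -/
noncomputable def frobSq {m n : ℕ} (X : Matrix (Fin m) (Fin n) ℂ) : ℝ := ∑ i, ∑ j, ‖X i j‖ ^ 2

lemma frobSq_nonneg {m n : ℕ} (X : Matrix (Fin m) (Fin n) ℂ) : 0 ≤ frobSq X := by
  unfold frobSq; positivity

lemma frobSq_smul {m n : ℕ} (c : ℂ) (X : Matrix (Fin m) (Fin n) ℂ) :
    frobSq (c • X) = ‖c‖ ^ 2 * frobSq X := by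
  simp [frobSq, Finset.mul_sum, mul_pow]

lemma conjTranspose_mul_self_col {m : ℕ} (u : Matrix (Fin m) (Fin 1) ℂ) :
    uᴴ * u = ((frobSq u : ℝ) : ℂ) • (1 : Matrix (Fin 1) (Fin 1) ℂ) := by
  ext i j
  rw [Subsingleton.elim i 0, Subsingleton.elim j 0]
  simp [Matrix.mul_apply, frobSq, Complex.conj_mul']

lemma mul_conjTranspose_self_row {n : ℕ} (v : Matrix (Fin 1) (Fin n) ℂ) :
    v * vᴴ = ((frobSq v : ℝ) : ℂ) • (1 : Matrix (Fin 1) (Fin 1) ℂ) := by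
  ext i j
  rw [Subsingleton.elim i 0, Subsingleton.elim j 0]
  simp [Matrix.mul_apply, frobSq, Complex.mul_conj']

open scoped ComplexOrder in
/-- The trace norm of a rank-one matrix is the product of the norms of its factors. -/
lemma trace_sqrt_rankOne {m n : ℕ} (c : ℂ) (u : Matrix (Fin m) (Fin 1) ℂ)
    (v : Matrix (Fin 1) (Fin n) ℂ) :
    (CFC.sqrt ((c • (u * v))ᴴ * (c • (u * v)))).trace.re = ‖c‖ * √(frobSq u * frobSq v) := by
  have hP : (vᴴ * v) * (vᴴ * v) = ((frobSq v : ℝ) : ℂ) • (vᴴ * v) := by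
    rw [Matrix.mul_assoc, ← Matrix.mul_assoc v, mul_conjTranspose_self_row]
    simp
  have hX : (c • (u * v))ᴴ * (c • (u * v)) =
      (((‖c‖ ^ 2 * frobSq u : ℝ)) : ℂ) • (vᴴ * v) := by
    rw [Matrix.conjTranspose_smul, Matrix.conjTranspose_mul, Matrix.smul_mul, Matrix.mul_smul,
      smul_smul, Matrix.mul_assoc, ← Matrix.mul_assoc uᴴ, conjTranspose_mul_self_col]
    simp only [Matrix.smul_mul, Matrix.one_mul, Matrix.mul_smul, smul_smul]
    congr 1
    push_cast
    rw [← Complex.conj_mul' c]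
    rfl
  have htr : (vᴴ * v).trace = ((frobSq v : ℝ) : ℂ) := by
    rw [Matrix.trace_mul_comm, mul_conjTranspose_self_row]
    simp
  have hPpos : 0 ≤ vᴴ * v := Matrix.nonneg_iff_posSemidef.2 (Matrix.posSemidef_conjTranspose_mul_self v)
  -- `P = vᴴ v` satisfies `P² = ‖v‖² P`, so `√P = P / ‖v‖`; for `v = 0` division by zero gives `0`.
  have hs : CFC.sqrt ((c • (u * v))ᴴ * (c • (u * v))) =
      (((‖c‖ * √(frobSq u) / √(frobSq v) : ℝ)) : ℂ) • (vᴴ * v) := by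
    rw [hX]
    refine CFC.sqrt_unique ?_ ?_
    · rw [Matrix.smul_mul, Matrix.mul_smul, hP, smul_smul, smul_smul, ← Complex.ofReal_mul,
        ← Complex.ofReal_mul]
      rcases eq_or_ne (frobSq v) 0 with h0 | h0
      · have hv : v = 0 := by
          ext i j
          have h1 := (Finset.sum_eq_zero_iff_of_nonneg (fun i _ => by positivity)).1 h0 i
            (Finset.mem_univ i)
          have h2 := (Finset.sum_eq_zero_iff_of_nonneg (fun j _ => by positivity)).1 h1 j
            (Finset.mem_univ j)
          simpa using h2
        simp [hv]
      · congr 2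
        have h1 := Real.mul_self_sqrt (frobSq_nonneg u)
        have h2 := Real.mul_self_sqrt (frobSq_nonneg v)
        have h3 : √(frobSq v) ≠ 0 := by rwa [ne_eq, Real.sqrt_eq_zero (frobSq_nonneg v)]
        field_simp
        rw [Real.sq_sqrt (frobSq_nonneg u), Real.sq_sqrt (frobSq_nonneg v)]
        ring
    · refine smul_nonneg ?_ hPpos
      exact Complex.zero_le_real.2 (by positivity)
  rw [hs, Matrix.trace_smul, htr, smul_eq_mul, ← Complex.ofReal_mul, Complex.ofReal_re,
    Real.sqrt_mul (frobSq_nonneg u), div_mul_eq_mul_div, mul_assoc, mul_div_assoc, mul_div_assoc]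
  congr 2
  exact Real.div_sqrt

lemma measurable_frobSq_onCircle {m n : ℕ} (X : Matrix (Fin m) (Fin n) (RatFunc ℝ)) :
    Measurable (fun ζ : Circle => frobSq (onCircle X ζ)) := by
  unfold frobSq
  refine Finset.measurable_sum _ fun i _ => Finset.measurable_sum _ fun j _ => ?_
  exact (measurable_evalAt (X i j)).norm.pow_const 2

lemma ae_evalAt_paraConj_mul {m : ℕ} (X : Matrix (Fin m) (Fin 1) (RatFunc ℝ)) :
    ∀ᵐ ζ : Circle ∂arcMeasure,
      evalAt ((paraConj X * X) 0 0) ζ = ((frobSq (onCircle X ζ) : ℝ) : ℂ) := by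
  have h1 : ∀ᵐ ζ : Circle ∂arcMeasure, ∀ i, evalAt (paraConj X 0 i * X i 0) ζ =
      evalAt (paraConj X 0 i) ζ * evalAt (X i 0) ζ := ae_all_iff.2 fun i => ae_evalAt_mul _ _
  have h2 : ∀ᵐ ζ : Circle ∂arcMeasure, ∀ i, evalAt (paraConj X 0 i) ζ =
      (starRingEnd ℂ) (evalAt (X i 0) ζ) := ae_all_iff.2 fun i => ae_evalAt_eval_inv _
  filter_upwards [ae_evalAt_sum Finset.univ fun i => paraConj X 0 i * X i 0, h1, h2]
    with ζ h3 h4 h5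
  rw [Matrix.mul_apply, h3]
  simp [h4, h5, frobSq, onCircle, Complex.conj_mul']

lemma ae_evalAt_mul_paraConj {n : ℕ} (X : Matrix (Fin 1) (Fin n) (RatFunc ℝ)) :
    ∀ᵐ ζ : Circle ∂arcMeasure,
      evalAt ((X * paraConj X) 0 0) ζ = ((frobSq (onCircle X ζ) : ℝ) : ℂ) := by
  have h1 : ∀ᵐ ζ : Circle ∂arcMeasure, ∀ i, evalAt (X 0 i * paraConj X i 0) ζ =
      evalAt (X 0 i) ζ * evalAt (paraConj X i 0) ζ := ae_all_iff.2 fun i => ae_evalAt_mul _ _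
  have h2 : ∀ᵐ ζ : Circle ∂arcMeasure, ∀ i, evalAt (paraConj X i 0) ζ =
      (starRingEnd ℂ) (evalAt (X 0 i) ζ) := ae_all_iff.2 fun i => ae_evalAt_eval_inv _
  filter_upwards [ae_evalAt_sum Finset.univ fun i => X 0 i * paraConj X i 0, h1, h2]
    with ζ h3 h4 h5
  rw [Matrix.mul_apply, h3]
  simp [h4, h5, frobSq, onCircle, Complex.mul_conj']

/-- A weight that agrees almost everywhere with a rational function without zeros and poles on the
circle is bounded above and away from zero. -/
lemma exists_ae_bounds {R : RatFunc ℝ} (hR : NoZerosPolesOnCircle R) {w : Circle → ℝ}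
    (hw0 : ∀ ζ, 0 ≤ w ζ) (hw : ∀ᵐ ζ : Circle ∂arcMeasure, evalAt R ζ = ((w ζ : ℝ) : ℂ)) :
    ∃ m M : ℝ, 0 < m ∧ 0 < M ∧ ∀ᵐ ζ ∂arcMeasure, m ≤ w ζ ∧ w ζ ≤ M := by
  obtain ⟨M, hM, hM'⟩ := exists_norm_evalAt_le fun ζ => (hR ζ).2
  obtain ⟨m, hm, hm'⟩ := exists_le_norm_evalAt (fun ζ => (hR ζ).2) fun ζ => (hR ζ).1
  refine ⟨m, M, hm, hM, ?_⟩
  filter_upwards [hw] with ζ hζ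
  have h : ‖evalAt R ζ‖ = w ζ := by
    rw [hζ, Complex.norm_real, Real.norm_of_nonneg (hw0 ζ)]
  exact ⟨h ▸ hm' ζ, h ▸ hM' ζ⟩

end NetworkedControl

/-! ### Cauchy–Schwarz and its equality case -/

lemma sq_lintegral_le_of_mul_eq_sq {Ω : Type*} [MeasurableSpace Ω] {μ : Measure Ω} {x y u : Ω → ℝ}
    (hx : AEMeasurable x μ) (hy : AEMeasurable y μ) (hx0 : ∀ ω, 0 ≤ x ω) (hu0 : ∀ ω, 0 ≤ u ω)
    (h : ∀ᵐ ω ∂μ, x ω * y ω = u ω ^ 2) :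
    (∫⁻ ω, ENNReal.ofReal (u ω) ∂μ) ^ 2 ≤
      (∫⁻ ω, ENNReal.ofReal (x ω) ∂μ) * ∫⁻ ω, ENNReal.ofReal (y ω) ∂μ := by
  have key := ENNReal.lintegral_mul_le_Lp_mul_Lq μ (p := 2) (q := 2)
    ⟨by norm_num, by norm_num, by norm_num⟩
    (hx.ennreal_ofReal.pow_const (1 / 2 : ℝ)) (hy.ennreal_ofReal.pow_const (1 / 2 : ℝ))
  have hhalf : ∀ t : ℝ≥0∞, (t ^ (1 / 2 : ℝ)) ^ (2 : ℝ) = t := fun t => by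
    rw [← ENNReal.rpow_mul]; norm_num
  have hhalf' : ∀ t : ℝ≥0∞, (t ^ (1 / 2 : ℝ)) ^ 2 = t := fun t => by
    rw [← ENNReal.rpow_natCast]; exact hhalf t
  simp only [hhalf, Pi.mul_apply] at key
  calc (∫⁻ ω, ENNReal.ofReal (u ω) ∂μ) ^ 2
      = (∫⁻ ω, ENNReal.ofReal (x ω) ^ (1 / 2 : ℝ) * ENNReal.ofReal (y ω) ^ (1 / 2 : ℝ) ∂μ) ^ 2 := by
        congr 1
        refine lintegral_congr_ae ?_
        filter_upwards [h] with ω hω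
        rw [← ENNReal.mul_rpow_of_nonneg _ _ (by norm_num), ← ENNReal.ofReal_mul (hx0 ω), hω,
          ENNReal.ofReal_pow (hu0 ω), ← ENNReal.rpow_natCast, ← ENNReal.rpow_mul]
        norm_num
    _ ≤ _ := by
        refine (pow_le_pow_left' key 2).trans_eq ?_
        rw [mul_pow, hhalf', hhalf']

/-- Equality in Cauchy–Schwarz: with `λ = L / α`, the function `λ² x + y - 2 λ u` is nonnegative and
has a nonpositive integral, so it vanishes, and `x y = u²` then leaves only `λ x = u`. -/
lemma ae_eq_of_lintegral_le {Ω : Type*} [MeasurableSpace Ω] {μ : Measure Ω} {x y u : Ω → ℝ}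
    {α L : ℝ} (hα : 0 < α) (hL : 0 < L)
    (hx : AEMeasurable x μ) (hy : AEMeasurable y μ) (hu : AEMeasurable u μ)
    (hx0 : ∀ ω, 0 ≤ x ω) (hy0 : ∀ ω, 0 ≤ y ω) (hu0 : ∀ ω, 0 ≤ u ω)
    (h : ∀ᵐ ω ∂μ, x ω * y ω = u ω ^ 2)
    (hxα : ∫⁻ ω, ENNReal.ofReal (x ω) ∂μ ≤ ENNReal.ofReal α)
    (hyL : ∫⁻ ω, ENNReal.ofReal (y ω) ∂μ ≤ ENNReal.ofReal (L ^ 2 / α))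
    (huL : ∫⁻ ω, ENNReal.ofReal (u ω) ∂μ = ENNReal.ofReal L) :
    ∀ᵐ ω ∂μ, x ω = α / L * u ω := by
  have hint : ∀ {f : Ω → ℝ} {c : ℝ}, AEMeasurable f μ → (∀ ω, 0 ≤ f ω) →
      ∫⁻ ω, ENNReal.ofReal (f ω) ∂μ ≤ ENNReal.ofReal c → Integrable f μ := fun hf hf0 hc =>
    ⟨hf.aestronglyMeasurable, (hasFiniteIntegral_iff_ofReal (Eventually.of_forall hf0)).2
      (hc.trans_lt ENNReal.ofReal_lt_top)⟩
  have hxi := hint hx hx0 hxα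
  have hyi := hint hy hy0 hyL
  have hui := hint hu hu0 huL.le
  have hle : ∀ {f : Ω → ℝ} {c : ℝ}, Integrable f μ → (∀ ω, 0 ≤ f ω) → 0 ≤ c →
      ∫⁻ ω, ENNReal.ofReal (f ω) ∂μ ≤ ENNReal.ofReal c → ∫ ω, f ω ∂μ ≤ c := by
    intro f c hf hf0 hc hfc
    rw [← ofReal_integral_eq_lintegral_ofReal hf (Eventually.of_forall hf0)] at hfc
    exact (ENNReal.ofReal_le_ofReal_iff hc).1 hfc
  have h1 := hle hxi hx0 hα.le hxα
  have h2 := hle hyi hy0 (by positivity) hyL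
  have h3 : ∫ ω, u ω ∂μ = L := by
    rw [← ofReal_integral_eq_lintegral_ofReal hui (Eventually.of_forall hu0)] at huL
    exact (ENNReal.ofReal_eq_ofReal_iff (integral_nonneg hu0) hL.le).1 huL
  set l := L / α with hl
  have hl0 : 0 < l := div_pos hL hα
  have hwi : Integrable (fun ω => l ^ 2 * x ω + y ω - 2 * l * u ω) μ :=
    ((hxi.const_mul _).add hyi).sub (hui.const_mul _)
  have hw0 : 0 ≤ᵐ[μ] fun ω => l ^ 2 * x ω + y ω - 2 * l * u ω := by
    filter_upwards [h] with ω hω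
    have h4 : (2 * l * u ω) ^ 2 ≤ (l ^ 2 * x ω + y ω) ^ 2 := by
      have : (l ^ 2 * x ω + y ω) ^ 2 - (2 * l * u ω) ^ 2 = (l ^ 2 * x ω - y ω) ^ 2 := by
        linear_combination (4 * l ^ 2) * hω
      nlinarith [sq_nonneg (l ^ 2 * x ω - y ω)]
    have h5 := abs_le_of_sq_le_sq h4 (add_nonneg (mul_nonneg (by positivity) (hx0 ω)) (hy0 ω))
    simp only [Pi.zero_apply]
    linarith [le_abs_self (2 * l * u ω)]
  have hw : ∫ ω, (l ^ 2 * x ω + y ω - 2 * l * u ω) ∂μ ≤ 0 := by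
    have hxy : Integrable (fun ω => l ^ 2 * x ω + y ω) μ := (hxi.const_mul _).add hyi
    rw [integral_sub hxy (hui.const_mul _),
      integral_add (hxi.const_mul _) hyi, integral_const_mul, integral_const_mul, h3]
    have h6 : l ^ 2 * ∫ ω, x ω ∂μ ≤ l ^ 2 * α := by gcongr
    have h7 : l ^ 2 * α + L ^ 2 / α - 2 * l * L = 0 := by
      rw [hl]; field_simp; ring
    linarith
  have hw' := (integral_eq_zero_iff_of_nonneg_ae hw0 hwi).1
    (le_antisymm hw (integral_nonneg_of_ae hw0))
  filter_upwards [h, hw'] with ω hω hω'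
  simp only [Pi.zero_apply] at hω'
  have h8 : (l ^ 2 * x ω - y ω) ^ 2 = 0 := by
    linear_combination (l ^ 2 * x ω + y ω + 2 * l * u ω) * hω' - (4 * l ^ 2) * hω
  have h9 : l ^ 2 * x ω = y ω := sub_eq_zero.1 (pow_eq_zero_iff (by norm_num) |>.1 h8)
  have h10 : l * (l * x ω - u ω) = 0 := by linarith
  have h11 : l * x ω = u ω := by
    rcases mul_eq_zero.1 h10 with h | h
    · exact absurd h hl0.ne'
    · linarith
  rw [← h11, hl]
  field_simp

namespace NetworkedControl

/-! ### The optimal factorization -/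

variable {nz nv : ℕ}

/-- The density whose integral is `‖C S G_yv‖₂²`. -/
noncomputable def constraintDensity (Gyu : RatFunc ℝ) (Gyv : Matrix (Fin 1) (Fin nv) (RatFunc ℝ))
    (K : RatFunc ℝ) (C : Circle → ℂ) (ζ : Circle) : ℝ :=
  ‖C ζ * evalAt (sens Gyu K) ζ‖ ^ 2 * frobSq (onCircle Gyv ζ)

/-- The density whose integral is `‖D S H G_zu‖₂²`. -/
noncomputable def costDensity (Gyu H : RatFunc ℝ) (Gzu : Matrix (Fin nz) (Fin 1) (RatFunc ℝ))
    (K : RatFunc ℝ) (D : Circle → ℂ) (ζ : Circle) : ℝ :=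
  ‖D ζ * evalAt (sens Gyu K) ζ * evalAt H ζ‖ ^ 2 * frobSq (onCircle Gzu ζ)

/-- The density whose integral is `‖K S² H G_zu G_yv‖₁`. -/
noncomputable def loopDensity (Gyu H : RatFunc ℝ) (Gzu : Matrix (Fin nz) (Fin 1) (RatFunc ℝ))
    (Gyv : Matrix (Fin 1) (Fin nv) (RatFunc ℝ)) (K : RatFunc ℝ) (ζ : Circle) : ℝ :=
  ‖evalAt K ζ * evalAt (sens Gyu K) ζ ^ 2 * evalAt H ζ‖ *
    √(frobSq (onCircle Gzu ζ) * frobSq (onCircle Gyv ζ))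

lemma norm2_smul_sq {m n : ℕ} (c : Circle → ℂ) (X : Circle → Matrix (Fin m) (Fin n) ℂ) :
    norm2 (fun ζ => c ζ • X ζ) ^ 2 =
      ∫⁻ ζ, ENNReal.ofReal (‖c ζ‖ ^ 2 * frobSq (X ζ)) ∂arcMeasure := by
  rw [norm2, ← ENNReal.rpow_natCast, ← ENNReal.rpow_mul, Nat.cast_ofNat,
    one_div_mul_cancel two_ne_zero, ENNReal.rpow_one]
  refine lintegral_congr fun ζ => ?_
  rw [← frobSq_smul]
  rfl

section

variable (Gyu H K : RatFunc ℝ) (Gzu : Matrix (Fin nz) (Fin 1) (RatFunc ℝ))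
  (Gyv : Matrix (Fin 1) (Fin nv) (RatFunc ℝ)) (C D : Circle → ℂ)

lemma norm2_constraint_sq :
    norm2 (fun ζ => (C ζ * evalAt (sens Gyu K) ζ) • onCircle Gyv ζ) ^ 2 =
      ∫⁻ ζ, ENNReal.ofReal (constraintDensity Gyu Gyv K C ζ) ∂arcMeasure :=
  norm2_smul_sq _ _

lemma cost_eq_lintegral :
    cost Gyu H Gzu K D = ∫⁻ ζ, ENNReal.ofReal (costDensity Gyu H Gzu K D ζ) ∂arcMeasure :=
  norm2_smul_sq _ _

lemma loopNorm_eq_lintegral :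
    loopNorm Gyu H Gzu Gyv K =
      ∫⁻ ζ, ENNReal.ofReal (loopDensity Gyu H Gzu Gyv K ζ) ∂arcMeasure := by
  simp only [loopNorm, norm1, trace_sqrt_rankOne, loopDensity]

lemma constraintDensity_nonneg (ζ : Circle) : 0 ≤ constraintDensity Gyu Gyv K C ζ :=
  mul_nonneg (by positivity) (frobSq_nonneg _)

lemma costDensity_nonneg (ζ : Circle) : 0 ≤ costDensity Gyu H Gzu K D ζ :=
  mul_nonneg (by positivity) (frobSq_nonneg _)

lemma loopDensity_nonneg (ζ : Circle) : 0 ≤ loopDensity Gyu H Gzu Gyv K ζ := by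
  unfold loopDensity; positivity

lemma measurable_loopDensity : Measurable (loopDensity Gyu H Gzu Gyv K) :=
  (((measurable_evalAt K).mul ((measurable_evalAt _).pow_const 2)).mul (measurable_evalAt H)).norm.mul
    ((measurable_frobSq_onCircle Gzu).mul (measurable_frobSq_onCircle Gyv)).sqrt

variable {C D}

lemma aemeasurable_constraintDensity (hC : AEMeasurable C arcMeasure) :
    AEMeasurable (constraintDensity Gyu Gyv K C) arcMeasure :=
  ((hC.mul (measurable_evalAt _).aemeasurable).norm.pow_const 2).mul
    (measurable_frobSq_onCircle Gyv).aemeasurable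

lemma aemeasurable_costDensity (hD : AEMeasurable D arcMeasure) :
    AEMeasurable (costDensity Gyu H Gzu K D) arcMeasure :=
  (((hD.mul (measurable_evalAt _).aemeasurable).mul
    (measurable_evalAt _).aemeasurable).norm.pow_const 2).mul
    (measurable_frobSq_onCircle Gzu).aemeasurable

lemma constraintDensity_mul_costDensity {ζ : Circle} (h : D ζ * C ζ = evalAt K ζ) :
    constraintDensity Gyu Gyv K C ζ * costDensity Gyu H Gzu K D ζ =
      loopDensity Gyu H Gzu Gyv K ζ ^ 2 := by
  rw [constraintDensity, costDensity, loopDensity, mul_pow, Real.sq_sqrt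
    (mul_nonneg (frobSq_nonneg _) (frobSq_nonneg _)), ← h]
  simp only [norm_mul, norm_pow]
  ring

end

variable {Gyu H K : RatFunc ℝ} {Gzu : Matrix (Fin nz) (Fin 1) (RatFunc ℝ)}
  {Gyv : Matrix (Fin 1) (Fin nv) (RatFunc ℝ)} {α : ℝ} {C D : Circle → ℂ}

lemma bound_le_cost (hα : 0 < α) (h : (C, D) ∈ feasible Gyu Gyv α K) :
    bound Gyu H Gzu Gyv α K ≤ cost Gyu H Gzu K D := by
  obtain ⟨hC, hD, hle, hDC⟩ := h
  rw [norm2_constraint_sq] at hle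
  have key := sq_lintegral_le_of_mul_eq_sq (aemeasurable_constraintDensity Gyu K Gyv hC)
    (aemeasurable_costDensity Gyu H K Gzu hD) (constraintDensity_nonneg Gyu K Gyv C)
    (loopDensity_nonneg Gyu H K Gzu Gyv)
    (hDC.mono fun ζ hζ => constraintDensity_mul_costDensity Gyu H K Gzu Gyv hζ)
  rw [← loopNorm_eq_lintegral, ← cost_eq_lintegral] at key
  calc bound Gyu H Gzu Gyv α K
      ≤ ENNReal.ofReal (1 / α) * (ENNReal.ofReal α * cost Gyu H Gzu K D) := by
        rw [bound]; gcongr; exact key.trans (by gcongr)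
    _ = cost Gyu H Gzu K D := by
        rw [← mul_assoc, ← ENNReal.ofReal_mul (by positivity), one_div, inv_mul_cancel₀ hα.ne',
          ENNReal.ofReal_one, one_mul]

/-- Nonvanishing of all the data at a point of the circle. -/
structure NonvanishingAt (Gyu H K : RatFunc ℝ) (Gzu : Matrix (Fin nz) (Fin 1) (RatFunc ℝ))
    (Gyv : Matrix (Fin 1) (Fin nv) (RatFunc ℝ)) (ζ : Circle) : Prop where
  controller : evalAt K ζ ≠ 0
  sensitivity : evalAt (sens Gyu K) ζ ≠ 0
  filter : evalAt H ζ ≠ 0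
  zu : 0 < frobSq (onCircle Gzu ζ)
  yv : 0 < frobSq (onCircle Gyv ζ)

lemma NonvanishingAt.loopDensity_pos {ζ : Circle} (h : NonvanishingAt Gyu H K Gzu Gyv ζ) :
    0 < loopDensity Gyu H Gzu Gyv K ζ := by
  refine mul_pos (norm_pos_iff.2 ?_) (Real.sqrt_pos.2 (mul_pos h.zu h.yv))
  exact mul_ne_zero (mul_ne_zero h.controller (pow_ne_zero 2 h.sensitivity)) h.filter

lemma loopNorm_ne_zero (hnv : ∀ᵐ ζ ∂arcMeasure, NonvanishingAt Gyu H K Gzu Gyv ζ) :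
    loopNorm Gyu H Gzu Gyv K ≠ 0 := by
  rw [loopNorm_eq_lintegral]
  intro h
  rw [lintegral_eq_zero_iff (measurable_loopDensity Gyu H K Gzu Gyv).ennreal_ofReal] at h
  obtain ⟨ζ, h1, h2⟩ := (h.and hnv).exists
  exact absurd (ENNReal.ofReal_eq_zero.1 h1) (not_le.2 h2.loopDensity_pos)

/-- The magnitude condition says that the constraint density is proportional to the loop density. -/
lemma magnitudeCondition_iff (hnv : ∀ᵐ ζ ∂arcMeasure, NonvanishingAt Gyu H K Gzu Gyv ζ) :
    MagnitudeCondition Gyu H Gzu Gyv α K C ↔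
      ∀ᵐ ζ ∂arcMeasure, constraintDensity Gyu Gyv K C ζ =
        α / (loopNorm Gyu H Gzu Gyv K).toReal * loopDensity Gyu H Gzu Gyv K ζ := by
  refine eventually_congr (hnv.mono fun ζ h => ?_)
  have hs : 0 < ‖evalAt (sens Gyu K) ζ‖ ^ 2 * frobSq (onCircle Gyv ζ) :=
    mul_pos (pow_pos (norm_pos_iff.2 h.sensitivity) 2) h.yv
  have hsqrt : √(frobSq (onCircle Gzu ζ) * frobSq (onCircle Gyv ζ)) =
      √(frobSq (onCircle Gzu ζ) / frobSq (onCircle Gyv ζ)) * frobSq (onCircle Gyv ζ) := by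
    rw [show frobSq (onCircle Gzu ζ) * frobSq (onCircle Gyv ζ) =
      frobSq (onCircle Gzu ζ) / frobSq (onCircle Gyv ζ) * frobSq (onCircle Gyv ζ) ^ 2 by
        have := h.yv.ne'
        field_simp, Real.sqrt_mul (div_nonneg h.zu.le h.yv.le), Real.sqrt_sq h.yv.le]
  rw [conjTranspose_mul_self_col, mul_conjTranspose_self_row, constraintDensity, loopDensity, hsqrt,
    ← mul_left_inj' hs.ne']
  simp only [Matrix.smul_apply, Matrix.one_apply_eq, smul_eq_mul, mul_one, Complex.ofReal_re,
    norm_mul, norm_pow]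
  constructor <;> intro h' <;> linear_combination h'

lemma bound_eq_ofReal (hα : 0 < α) (hL : loopNorm Gyu H Gzu Gyv K < ⊤) :
    bound Gyu H Gzu Gyv α K = ENNReal.ofReal ((loopNorm Gyu H Gzu Gyv K).toReal ^ 2 / α) := by
  rw [bound, div_eq_inv_mul (_ ^ 2), ENNReal.ofReal_mul (by positivity),
    ENNReal.ofReal_pow ENNReal.toReal_nonneg, ENNReal.ofReal_toReal hL.ne, one_div]

lemma magnitudeCondition_of_cost_eq (hα : 0 < α)
    (hnv : ∀ᵐ ζ ∂arcMeasure, NonvanishingAt Gyu H K Gzu Gyv ζ)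
    (hL : loopNorm Gyu H Gzu Gyv K < ⊤) (h : (C, D) ∈ feasible Gyu Gyv α K)
    (hcost : cost Gyu H Gzu K D = bound Gyu H Gzu Gyv α K) :
    MagnitudeCondition Gyu H Gzu Gyv α K C := by
  obtain ⟨hC, hD, hle, hDC⟩ := h
  rw [norm2_constraint_sq] at hle
  rw [cost_eq_lintegral, bound_eq_ofReal hα hL] at hcost
  rw [magnitudeCondition_iff hnv]
  exact ae_eq_of_lintegral_le hα (ENNReal.toReal_pos (loopNorm_ne_zero hnv) hL.ne)
    (aemeasurable_constraintDensity Gyu K Gyv hC) (aemeasurable_costDensity Gyu H K Gzu hD)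
    (measurable_loopDensity Gyu H K Gzu Gyv).aemeasurable (constraintDensity_nonneg Gyu K Gyv C)
    (costDensity_nonneg Gyu H K Gzu D) (loopDensity_nonneg Gyu H K Gzu Gyv)
    (hDC.mono fun ζ hζ => constraintDensity_mul_costDensity Gyu H K Gzu Gyv hζ) hle hcost.le
    (by rw [← loopNorm_eq_lintegral, ENNReal.ofReal_toReal hL.ne])

/-- Under the magnitude condition both densities are multiples of the loop density, so the power
constraint is active and the cost equals the lower bound. -/
lemma feasible_and_cost_eq_of_magnitudeCondition (hα : 0 < α)
    (hnv : ∀ᵐ ζ ∂arcMeasure, NonvanishingAt Gyu H K Gzu Gyv ζ)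
    (hL : loopNorm Gyu H Gzu Gyv K < ⊤) (hC : AEMeasurable C arcMeasure)
    (hD : AEMeasurable D arcMeasure) (hDC : ∀ᵐ ζ ∂arcMeasure, D ζ * C ζ = evalAt K ζ)
    (hM : MagnitudeCondition Gyu H Gzu Gyv α K C) :
    (C, D) ∈ feasible Gyu Gyv α K ∧ cost Gyu H Gzu K D = bound Gyu H Gzu Gyv α K := by
  rw [magnitudeCondition_iff hnv] at hM
  set L := (loopNorm Gyu H Gzu Gyv K).toReal with hLdef
  have hL0 : 0 < L := ENNReal.toReal_pos (loopNorm_ne_zero hnv) hL.ne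
  have hint : ∀ {f : Circle → ℝ} {c : ℝ}, 0 ≤ c →
      (∀ᵐ ζ ∂arcMeasure, f ζ = c * loopDensity Gyu H Gzu Gyv K ζ) →
      ∫⁻ ζ, ENNReal.ofReal (f ζ) ∂arcMeasure = ENNReal.ofReal (c * L) := by
    intro f c hc hf
    rw [ENNReal.ofReal_mul hc, hLdef, ENNReal.ofReal_toReal hL.ne, loopNorm_eq_lintegral,
      ← lintegral_const_mul _ (measurable_loopDensity Gyu H K Gzu Gyv).ennreal_ofReal]
    refine lintegral_congr_ae (hf.mono fun ζ hζ => ?_)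
    simp only
    rw [hζ, ENNReal.ofReal_mul hc]
  refine ⟨⟨hC, hD, ?_, hDC⟩, ?_⟩
  · rw [norm2_constraint_sq, hint (by positivity) hM, div_mul_cancel₀ _ hL0.ne']
  · rw [cost_eq_lintegral, bound_eq_ofReal hα hL, hint (c := L / α) (by positivity)]
    · congr 1
      ring
    · filter_upwards [hM, hDC, hnv] with ζ h1 h2 h3
      have h4 := constraintDensity_mul_costDensity Gyu H K Gzu Gyv h2
      have h5 := h3.loopDensity_pos.ne'
      have h6 : α / L ≠ 0 := (div_pos hα hL0).ne'
      rw [h1] at h4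
      field_simp at h4 ⊢
      linear_combination h4

/-- Any `C` satisfying the magnitude condition is almost everywhere nonzero and thus has the partner
`D = K / C`. -/
lemma ae_div_mul_cancel_of_magnitudeCondition (hα : 0 < α)
    (hnv : ∀ᵐ ζ ∂arcMeasure, NonvanishingAt Gyu H K Gzu Gyv ζ)
    (hL : loopNorm Gyu H Gzu Gyv K < ⊤) (hM : MagnitudeCondition Gyu H Gzu Gyv α K C) :
    ∀ᵐ ζ : Circle ∂arcMeasure, evalAt K ζ / C ζ * C ζ = evalAt K ζ := by
  rw [magnitudeCondition_iff hnv] at hM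
  have hL0 := ENNReal.toReal_pos (loopNorm_ne_zero hnv) hL.ne
  filter_upwards [hM, hnv] with ζ h1 h2
  refine div_mul_cancel₀ _ fun h => ?_
  have h3 : 0 < α / (loopNorm Gyu H Gzu Gyv K).toReal * loopDensity Gyu H Gzu Gyv K ζ :=
    mul_pos (div_pos hα hL0) h2.loopDensity_pos
  rw [← h1, constraintDensity, h] at h3
  simp at h3

lemma isOptimal_of_cost_eq_bound (hα : 0 < α) (h : (C, D) ∈ feasible Gyu Gyv α K)
    (hcost : cost Gyu H Gzu K D = bound Gyu H Gzu Gyv α K) :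
    IsOptimal Gyu H Gzu Gyv α K C D :=
  ⟨h, fun p hp => hcost.trans_le (bound_le_cost (C := p.1) hα hp)⟩

lemma iInf_cost_eq_bound (hα : 0 < α) (h : (C, D) ∈ feasible Gyu Gyv α K)
    (hcost : cost Gyu H Gzu K D = bound Gyu H Gzu Gyv α K) :
    (⨅ p ∈ feasible Gyu Gyv α K, cost Gyu H Gzu K p.2) = bound Gyu H Gzu Gyv α K :=
  le_antisymm ((iInf₂_le (C, D) h).trans_eq hcost)
    (le_iInf₂ fun p hp => bound_le_cost (C := p.1) hα hp)

/-- The nonnegative square root of the optimal `|C|²`, without regard to analyticity, already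
attains the bound. -/
lemma exists_feasible_cost_eq_bound (hα : 0 < α)
    (hnv : ∀ᵐ ζ ∂arcMeasure, NonvanishingAt Gyu H K Gzu Gyv ζ)
    (hL : loopNorm Gyu H Gzu Gyv K < ⊤) :
    ∃ p ∈ feasible Gyu Gyv α K, cost Gyu H Gzu K p.2 = bound Gyu H Gzu Gyv α K := by
  set C : Circle → ℂ := fun ζ => ((√(α / (loopNorm Gyu H Gzu Gyv K).toReal *
      √(frobSq (onCircle Gzu ζ) / frobSq (onCircle Gyv ζ)) * ‖evalAt K ζ * evalAt H ζ‖) : ℝ) : ℂ)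
    with hCdef
  have hC : Measurable C :=
    Complex.measurable_ofReal.comp ((measurable_const.mul ((measurable_frobSq_onCircle Gzu).div
      (measurable_frobSq_onCircle Gyv)).sqrt).mul
        ((measurable_evalAt K).mul (measurable_evalAt H)).norm).sqrt
  have hM : MagnitudeCondition Gyu H Gzu Gyv α K C := by
    refine Eventually.of_forall fun ζ => ?_
    rw [conjTranspose_mul_self_col, mul_conjTranspose_self_row, hCdef]
    simp only [Complex.norm_real, Real.norm_eq_abs, sq_abs, Matrix.smul_apply, Matrix.one_apply_eq,
      smul_eq_mul, mul_one, Complex.ofReal_re]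
    rw [Real.sq_sqrt]
    have := ENNReal.toReal_nonneg (a := loopNorm Gyu H Gzu Gyv K)
    positivity
  have h := feasible_and_cost_eq_of_magnitudeCondition hα hnv hL hC.aemeasurable
    ((measurable_evalAt K).div hC).aemeasurable
    (ae_div_mul_cancel_of_magnitudeCondition hα hnv hL hM) hM
  exact ⟨_, h.1, h.2⟩

end NetworkedControl

namespace NetworkedControl

variable {nz nv : ℕ} {Gyu H K : RatFunc ℝ} {Gzu : Matrix (Fin nz) (Fin 1) (RatFunc ℝ)}
  {Gyv : Matrix (Fin 1) (Fin nv) (RatFunc ℝ)} {α : ℝ}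

/-! ### Bounds on the data and the outer optimal factor -/

lemma IsRHinf.not_hasPole {R : RatFunc ℝ} (h : IsRHinf R) (ζ : Circle) : ¬ HasPole R ζ :=
  h.2 ζ (Circle.norm_coe ζ).ge

lemma exists_frobSq_zu_bounds (hGzu : NoZerosPolesOnCircle ((paraConj Gzu * Gzu) 0 0)) :
    ∃ m M : ℝ, 0 < m ∧ 0 < M ∧
      ∀ᵐ ζ ∂arcMeasure, m ≤ frobSq (onCircle Gzu ζ) ∧ frobSq (onCircle Gzu ζ) ≤ M :=
  exists_ae_bounds hGzu (fun _ => frobSq_nonneg _) (ae_evalAt_paraConj_mul Gzu)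

lemma exists_frobSq_yv_bounds (hGyv : NoZerosPolesOnCircle ((Gyv * paraConj Gyv) 0 0)) :
    ∃ m M : ℝ, 0 < m ∧ 0 < M ∧
      ∀ᵐ ζ ∂arcMeasure, m ≤ frobSq (onCircle Gyv ζ) ∧ frobSq (onCircle Gyv ζ) ≤ M :=
  exists_ae_bounds hGyv (fun _ => frobSq_nonneg _) (ae_evalAt_mul_paraConj Gyv)

lemma ae_nonvanishingAt (hGyu : IsStrictlyProper Gyu) (hK : IsProper K) (hK0 : K ≠ 0)
    (hH0 : ∀ ζ : Circle, ¬ HasZero H ζ)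
    (hGzu : NoZerosPolesOnCircle ((paraConj Gzu * Gzu) 0 0))
    (hGyv : NoZerosPolesOnCircle ((Gyv * paraConj Gyv) 0 0)) :
    ∀ᵐ ζ ∂arcMeasure, NonvanishingAt Gyu H K Gzu Gyv ζ := by
  obtain ⟨m, M, hm, hM, h⟩ := exists_frobSq_zu_bounds hGzu
  obtain ⟨m', M', hm', hM', h'⟩ := exists_frobSq_yv_bounds hGyv
  filter_upwards [h, h', ae_evalAt_ne_zero hK0, ae_evalAt_ne_zero (sens_ne_zero hGyu hK),
    ae_evalAt_ne_zero (ne_zero_of_not_hasZero hH0)] with ζ h1 h2 h3 h4 h5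
  exact ⟨h3, h4, h5, hm.trans_le h1.1, hm'.trans_le h2.1⟩

lemma loopNorm_lt_top (hK : IsRL K) (hS : IsRHinf (sens Gyu K)) (hH : IsRHinf H)
    (hGzu : NoZerosPolesOnCircle ((paraConj Gzu * Gzu) 0 0))
    (hGyv : NoZerosPolesOnCircle ((Gyv * paraConj Gyv) 0 0)) :
    loopNorm Gyu H Gzu Gyv K < ⊤ := by
  obtain ⟨_, Ma, -, hMa, ha⟩ := exists_frobSq_zu_bounds hGzu
  obtain ⟨_, Mb, -, hMb, hb⟩ := exists_frobSq_yv_bounds hGyv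
  obtain ⟨Bk, hBk, hk⟩ := exists_norm_evalAt_le hK.2
  obtain ⟨Bs, hBs, hs⟩ := exists_norm_evalAt_le hS.not_hasPole
  obtain ⟨Bh, hBh, hh⟩ := exists_norm_evalAt_le hH.not_hasPole
  rw [loopNorm_eq_lintegral]
  calc ∫⁻ ζ, ENNReal.ofReal (loopDensity Gyu H Gzu Gyv K ζ) ∂arcMeasure
      ≤ ∫⁻ _, ENNReal.ofReal (Bk * Bs ^ 2 * Bh * √(Ma * Mb)) ∂arcMeasure := by
        refine lintegral_mono_ae ?_
        filter_upwards [ha, hb] with ζ h1 h2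
        refine ENNReal.ofReal_le_ofReal ?_
        rw [loopDensity, norm_mul, norm_mul, norm_pow]
        have := frobSq_nonneg (onCircle Gyv ζ)
        have := hk ζ
        have := hs ζ
        have := hh ζ
        gcongr
        · exact h1.2
        · exact h2.2
    _ < ⊤ := by simp

/-- The fourth power of the optimal modulus is a constant times the modulus of the rational function
`G_zu* G_zu (K H)² / (G_yv G_yv*)`. So its logarithm is integrable and, off finitely many points,
differentiable, and the outer function with this modulus has radial limits there. -/
lemma exists_isOuterH2_magnitudeCondition (hα : 0 < α)
    (hnv : ∀ᵐ ζ ∂arcMeasure, NonvanishingAt Gyu H K Gzu Gyv ζ)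
    (hL : loopNorm Gyu H Gzu Gyv K < ⊤) (hK : IsRL K) (hK0 : K ≠ 0)
    (hH : IsRHinf H) (hH0 : ∀ ζ : Circle, ¬ HasZero H ζ)
    (hGzu : NoZerosPolesOnCircle ((paraConj Gzu * Gzu) 0 0))
    (hGyv : NoZerosPolesOnCircle ((Gyv * paraConj Gyv) 0 0)) :
    ∃ C : Circle → ℂ, AEMeasurable C arcMeasure ∧ IsOuterH2 C ∧
      MagnitudeCondition Gyu H Gzu Gyv α K C := by
  have hL0 := ENNReal.toReal_pos (loopNorm_ne_zero hnv) hL.ne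
  set c := α / (loopNorm Gyu H Gzu Gyv K).toReal with hc
  have hc0 : 0 < c := div_pos hα hL0
  set g : RatFunc ℝ :=
    (paraConj Gzu * Gzu) 0 0 * (K * H) ^ 2 / (Gyv * paraConj Gyv) 0 0 with hg
  have hg0 : g ≠ 0 := div_ne_zero (mul_ne_zero (ne_zero_of_not_hasZero fun ζ => (hGzu ζ).1)
    (pow_ne_zero 2 (mul_ne_zero hK0 (ne_zero_of_not_hasZero hH0))))
    (ne_zero_of_not_hasZero fun ζ => (hGyv ζ).1)
  have hgval : ∀ᵐ ζ : Circle ∂arcMeasure, ‖evalAt g ζ‖ =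
      frobSq (onCircle Gzu ζ) / frobSq (onCircle Gyv ζ) * ‖evalAt K ζ * evalAt H ζ‖ ^ 2 := by
    filter_upwards [ae_evalAt_div ((paraConj Gzu * Gzu) 0 0 * (K * H) ^ 2)
      ((Gyv * paraConj Gyv) 0 0), ae_evalAt_mul ((paraConj Gzu * Gzu) 0 0) ((K * H) ^ 2),
      ae_evalAt_pow (K * H) 2, ae_evalAt_mul K H, ae_evalAt_paraConj_mul Gzu,
      ae_evalAt_mul_paraConj Gyv] with ζ h1 h2 h3 h4 h5 h6
    rw [hg, h1, h2, h3, h4, h5, h6, norm_div, norm_mul, Complex.norm_real, Complex.norm_real,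
      Real.norm_of_nonneg (frobSq_nonneg _), Real.norm_of_nonneg (frobSq_nonneg _), norm_pow]
    ring
  -- At the zeros and poles of `g`, where `evalAt g` is `0`, the value `Real.log 0 = 0` keeps `ℓ` real;
  -- these finitely many points do not matter.
  set ℓ : Circle → ℝ := fun ζ => Real.log c / 2 + 1 / 4 * Real.log ‖evalAt g ζ‖ with hℓ
  have hm : Measurable ℓ := ((measurable_evalAt g).norm.log.const_mul _).const_add _
  have hi : Integrable ℓ arcMeasure :=
    (integrable_const _).add ((integrable_log_norm_evalAt g).const_mul _)
  have hO : ∀ᵐ ζ₀ ∂arcMeasure,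
      (fun ζ : Circle => ℓ ζ - ℓ ζ₀) =O[𝓝 ζ₀] fun ζ : Circle => (ζ : ℂ) - ζ₀ := by
    filter_upwards [ae_isBigO_log_norm_evalAt hg0] with ζ₀ h
    refine (h.const_mul_left (1 / 4)).congr_left fun ζ => ?_
    simp only [hℓ]
    ring
  obtain ⟨_, Ma, -, hMa, ha⟩ := exists_frobSq_zu_bounds hGzu
  obtain ⟨mb, _, hmb, -, hb⟩ := exists_frobSq_yv_bounds hGyv
  obtain ⟨Bk, hBk, hk⟩ := exists_norm_evalAt_le hK.2
  obtain ⟨Bh, hBh, hh⟩ := exists_norm_evalAt_le hH.not_hasPole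
  have hB : ∀ᵐ ζ ∂arcMeasure,
      ℓ ζ ≤ Real.log c / 2 + 1 / 4 * Real.log (Ma / mb * (Bk * Bh) ^ 2) := by
    filter_upwards [hgval, ha, hb, ae_evalAt_ne_zero hg0] with ζ h1 h2 h3 h4
    simp only [hℓ]
    have h5 := norm_pos_iff.2 h4
    have h6 : ‖evalAt g ζ‖ ≤ Ma / mb * (Bk * Bh) ^ 2 := by
      rw [h1, norm_mul]
      have := hk ζ
      have := hh ζ
      gcongr
      · exact h2.2
      · exact h3.1
    gcongr
  refine ⟨outerBoundary ℓ, aemeasurable_outerBoundary hi hO, isOuterH2_outerBoundary hm hi hB hO, ?_⟩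
  filter_upwards [hgval, ae_evalAt_ne_zero hg0] with ζ h1 h2
  rw [conjTranspose_mul_self_col, mul_conjTranspose_self_row, norm_outerBoundary, ← hc]
  simp only [Matrix.smul_apply, Matrix.one_apply_eq, smul_eq_mul, mul_one, Complex.ofReal_re]
  have h3 := norm_pos_iff.2 h2
  rw [← Real.exp_nat_mul, hℓ]
  have h4 : ((2 : ℕ) : ℝ) * (Real.log c / 2 + 1 / 4 * Real.log ‖evalAt g ζ‖) =
      Real.log c + Real.log ‖evalAt g ζ‖ / 2 := by push_cast; ring
  simp only
  rw [h4, Real.exp_add, Real.exp_log hc0, Real.exp_half, Real.exp_log h3, h1, Real.sqrt_mul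
    (div_nonneg (frobSq_nonneg _) (frobSq_nonneg _)), Real.sqrt_sq (norm_nonneg _), mul_assoc]

/-- The decoder `K / C` is bounded: `|D|² = |K| √(G_yv G_yv* / G_zu* G_zu) / (c |H|)`, and `H` has no
zeros on the circle. -/
lemma memLp_div_of_magnitudeCondition {C : Circle → ℂ} (hα : 0 < α)
    (hnv : ∀ᵐ ζ ∂arcMeasure, NonvanishingAt Gyu H K Gzu Gyv ζ)
    (hL : loopNorm Gyu H Gzu Gyv K < ⊤) (hK : IsRL K)
    (hH : IsRHinf H) (hH0 : ∀ ζ : Circle, ¬ HasZero H ζ)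
    (hGzu : NoZerosPolesOnCircle ((paraConj Gzu * Gzu) 0 0))
    (hGyv : NoZerosPolesOnCircle ((Gyv * paraConj Gyv) 0 0))
    (hC : AEMeasurable C arcMeasure) (hM : MagnitudeCondition Gyu H Gzu Gyv α K C) :
    MemLp (fun ζ : Circle => evalAt K ζ / C ζ) 2 arcMeasure := by
  have hL0 := ENNReal.toReal_pos (loopNorm_ne_zero hnv) hL.ne
  have hc0 := div_pos hα hL0
  obtain ⟨ma, _, hma, -, ha⟩ := exists_frobSq_zu_bounds hGzu
  obtain ⟨_, Mb, -, hMb, hb⟩ := exists_frobSq_yv_bounds hGyv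
  obtain ⟨Bk, hBk, hk⟩ := exists_norm_evalAt_le hK.2
  obtain ⟨mh, hmh, hh⟩ := exists_le_norm_evalAt hH.not_hasPole hH0
  refine MemLp.of_bound ((measurable_evalAt K).aemeasurable.div hC).aestronglyMeasurable
    (√(Bk / (α / (loopNorm Gyu H Gzu Gyv K).toReal * √(ma / Mb) * mh))) ?_
  filter_upwards [hM, ha, hb, hnv] with ζ h1 h2 h3 h4
  rw [conjTranspose_mul_self_col, mul_conjTranspose_self_row] at h1
  simp only [Matrix.smul_apply, Matrix.one_apply_eq, smul_eq_mul, mul_one, Complex.ofReal_re,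
    norm_mul] at h1
  refine Real.le_sqrt_of_sq_le ?_
  have hk0 : 0 < ‖evalAt K ζ‖ := norm_pos_iff.2 h4.controller
  have hyv := h4.yv
  have hzu := h4.zu.le
  have h5 : ‖evalAt K ζ / C ζ‖ ^ 2 = ‖evalAt K ζ‖ / (α / (loopNorm Gyu H Gzu Gyv K).toReal *
      √(frobSq (onCircle Gzu ζ) / frobSq (onCircle Gyv ζ)) * ‖evalAt H ζ‖) := by
    rw [norm_div, div_pow, h1, mul_left_comm, sq, mul_div_mul_left _ _ hk0.ne']
  rw [h5]
  have := hk ζ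
  have := hh ζ
  gcongr
  · exact h2.1
  · exact h3.2

lemma isOptimal_zero {C : Circle → ℂ} (hK : K = 0) (hC : AEMeasurable C arcMeasure)
    (hle : norm2 (fun ζ => (C ζ * evalAt (sens Gyu K) ζ) • onCircle Gyv ζ) ^ 2 ≤
      ENNReal.ofReal α) :
    IsOptimal Gyu H Gzu Gyv α K C 0 ∧ cost Gyu H Gzu K (0 : Circle → ℂ) = 0 := by
  have hcost : cost Gyu H Gzu K (0 : Circle → ℂ) = 0 := by
    rw [cost_eq_lintegral]
    simp [costDensity]
  refine ⟨⟨⟨hC, aemeasurable_const, hle, Eventually.of_forall fun ζ => ?_⟩, fun p _ => ?_⟩, hcost⟩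
  · simp [hK, evalAt_zero]
  · rw [hcost]
    exact zero_le

lemma bound_zero : bound Gyu H Gzu Gyv α 0 = 0 := by
  rw [bound, loopNorm_eq_lintegral]
  simp [loopDensity, evalAt_zero]

/-- A small positive constant is an outer function meeting the power constraint. -/
lemma exists_isOuterH2_constraint (hα : 0 < α) (hS : IsRHinf (sens Gyu K))
    (hGyv : NoZerosPolesOnCircle ((Gyv * paraConj Gyv) 0 0)) :
    ∃ C : Circle → ℂ, AEMeasurable C arcMeasure ∧ IsOuterH2 C ∧
      norm2 (fun ζ => (C ζ * evalAt (sens Gyu K) ζ) • onCircle Gyv ζ) ^ 2 ≤ ENNReal.ofReal α := by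
  obtain ⟨_, Mb, -, hMb, hb⟩ := exists_frobSq_yv_bounds hGyv
  obtain ⟨Bs, hBs, hs⟩ := exists_norm_evalAt_le hS.not_hasPole
  set ε : ℝ := √(α / (Bs ^ 2 * Mb)) with hε
  have hε0 : 0 < ε := Real.sqrt_pos.2 (by positivity)
  have hi : Integrable (fun _ : Circle => Real.log ε) arcMeasure := integrable_const _
  have hO : ∀ᵐ ζ₀ : Circle ∂arcMeasure, (fun _ : Circle => Real.log ε - Real.log ε) =O[𝓝 ζ₀]
      fun ζ : Circle => (ζ : ℂ) - ζ₀ := Eventually.of_forall fun ζ₀ => by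
    simpa using Asymptotics.isBigO_zero _ _
  refine ⟨outerBoundary fun _ => Real.log ε, aemeasurable_outerBoundary hi hO,
    isOuterH2_outerBoundary measurable_const hi (Eventually.of_forall fun _ => le_rfl) hO, ?_⟩
  rw [norm2_constraint_sq]
  calc ∫⁻ ζ, ENNReal.ofReal
        (constraintDensity Gyu Gyv K (outerBoundary fun _ => Real.log ε) ζ) ∂arcMeasure
      ≤ ∫⁻ _, ENNReal.ofReal α ∂arcMeasure := by
        refine lintegral_mono_ae ?_
        filter_upwards [hb] with ζ h
        refine ENNReal.ofReal_le_ofReal ?_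
        rw [constraintDensity, norm_mul, norm_outerBoundary, Real.exp_log hε0, mul_pow, hε,
          Real.sq_sqrt (by positivity)]
        have := hs ζ
        have := frobSq_nonneg (onCircle Gyv ζ)
        calc _ ≤ α / (Bs ^ 2 * Mb) * Bs ^ 2 * Mb := by
              gcongr
              exact h.2
          _ = α := by field_simp
    _ = ENNReal.ofReal α := by simp

end NetworkedControl

open NetworkedControl in
theorem lemma3 (nz nv : ℕ) (α : ℝ) (Gyu H K : RatFunc ℝ)
    (Gzu : Matrix (Fin nz) (Fin 1) (RatFunc ℝ)) (Gyv : Matrix (Fin 1) (Fin nv) (RatFunc ℝ))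
    (hα : 0 < α)
    (hGyu : IsStrictlyProper Gyu)
    (hK : IsProper K)
    (hS : IsRHinf (sens Gyu K))
    (hH : IsRHinf H) (hH0 : ∀ ζ : Circle, ¬ HasZero H ζ)
    (hGzu : NoZerosPolesOnCircle ((paraConj Gzu * Gzu) 0 0))
    (hGyv : NoZerosPolesOnCircle ((Gyv * paraConj Gyv) 0 0)) :
    -- the lower bound
    (bound Gyu H Gzu Gyv α K ≤ ⨅ p ∈ feasible Gyu Gyv α K, cost Gyu H Gzu K p.2) ∧
    -- the bound is attained, with `C` outer in `H²` and `D` in `L²`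
    (IsRL K → IsYoula Gyu K →
      ∃ C D : Circle → ℂ, (C, D) ∈ feasible Gyu Gyv α K ∧
        IsOuterH2 C ∧ MemLp D 2 arcMeasure ∧
        IsOptimal Gyu H Gzu Gyv α K C D ∧
        cost Gyu H Gzu K D = bound Gyu H Gzu Gyv α K ∧
        (⨅ p ∈ feasible Gyu Gyv α K, cost Gyu H Gzu K p.2) = bound Gyu H Gzu Gyv α K) ∧
    -- the norm in the bound is finite if `K` has no poles on the circle
    (IsRL K → loopNorm Gyu H Gzu Gyv K < ⊤) ∧
    -- the optimal pairs for nonzero `K`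
    (K ≠ 0 → loopNorm Gyu H Gzu Gyv K < ⊤ →
      ∀ C D : Circle → ℂ, AEMeasurable C arcMeasure → AEMeasurable D arcMeasure →
        (IsOptimal Gyu H Gzu Gyv α K C D ↔
          (∀ᵐ ζ ∂arcMeasure, D ζ * C ζ = evalAt K ζ) ∧
            MagnitudeCondition Gyu H Gzu Gyv α K C) ∧
        (IsOptimal Gyu H Gzu Gyv α K C D ↔
          (C, D) ∈ feasible Gyu Gyv α K ∧
            cost Gyu H Gzu K D = bound Gyu H Gzu Gyv α K)) ∧
    -- the case `K = 0`
    (K = 0 → ∀ C : Circle → ℂ, AEMeasurable C arcMeasure →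
      norm2 (fun ζ => (C ζ * evalAt (sens Gyu K) ζ) • onCircle Gyv ζ) ^ 2 ≤ ENNReal.ofReal α →
      IsOptimal Gyu H Gzu Gyv α K C 0 ∧ cost Gyu H Gzu K (0 : Circle → ℂ) = 0) := by
  refine ⟨le_iInf₂ fun p hp => bound_le_cost (C := p.1) hα hp, fun hRL _ => ?_,
    fun hRL => loopNorm_lt_top hRL hS hH hGzu hGyv, fun hK0 hL C D hC hD => ?_,
    fun hK0 C hC hle => isOptimal_zero hK0 hC hle⟩
  · rcases eq_or_ne K 0 with hK0 | hK0
    · obtain ⟨C, hC, hout, hle⟩ := exists_isOuterH2_constraint (Gyu := Gyu) (K := K) hα hS hGyv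
      obtain ⟨hopt, hcost⟩ := isOptimal_zero (H := H) (Gzu := Gzu) hK0 hC hle
      have hcost' : cost Gyu H Gzu K 0 = bound Gyu H Gzu Gyv α K := by
        rw [hcost, hK0, bound_zero]
      exact ⟨C, 0, hopt.1, hout, MemLp.zero, hopt, hcost', iInf_cost_eq_bound hα hopt.1 hcost'⟩
    · have hnv := ae_nonvanishingAt hGyu hK hK0 hH0 hGzu hGyv
      have hL := loopNorm_lt_top hRL hS hH hGzu hGyv
      obtain ⟨C, hC, hout, hM⟩ :=
        exists_isOuterH2_magnitudeCondition hα hnv hL hRL hK0 hH hH0 hGzu hGyv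
      have hD := memLp_div_of_magnitudeCondition hα hnv hL hRL hH hH0 hGzu hGyv hC hM
      obtain ⟨hf, hcost⟩ := feasible_and_cost_eq_of_magnitudeCondition hα hnv hL hC
        hD.aestronglyMeasurable.aemeasurable
        (ae_div_mul_cancel_of_magnitudeCondition hα hnv hL hM) hM
      exact ⟨C, _, hf, hout, hD, isOptimal_of_cost_eq_bound hα hf hcost, hcost,
        iInf_cost_eq_bound hα hf hcost⟩
  · have hnv := ae_nonvanishingAt hGyu hK hK0 hH0 hGzu hGyv
    have hopt : IsOptimal Gyu H Gzu Gyv α K C D ↔ (C, D) ∈ feasible Gyu Gyv α K ∧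
        cost Gyu H Gzu K D = bound Gyu H Gzu Gyv α K := by
      refine ⟨fun h => ⟨h.1, le_antisymm ?_ (bound_le_cost hα h.1)⟩,
        fun h => isOptimal_of_cost_eq_bound hα h.1 h.2⟩
      obtain ⟨p, hp, hpc⟩ := exists_feasible_cost_eq_bound hα hnv hL
      exact (h.2 p hp).trans_eq hpc
    refine ⟨hopt.trans ⟨fun h => ⟨h.1.2.2.2, magnitudeCondition_of_cost_eq hα hnv hL h.1 h.2⟩,
      fun h => feasible_and_cost_eq_of_magnitudeCondition hα hnv hL hC hD h.1 h.2⟩, hopt⟩
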